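/- Let $\sigma:[0,1]\to[0,\infty)$ be Borel measurable, bounded, and nonzero Lebesgue-almost everywhere. Let $(W_i)_{i\in\mathbb Z}$ be independent standard Brownian motions, and let $(g_i)_{i\in\mathbb Z}$ be almost surely positive random variables such that the families $(W_i)_i$ and $(g_i)_i$ are independent. Assume that $(\log g_i)_{i\in\mathbb Z}$ is a strictly stationary solution of $$\log g_i=\varphi_1\log g_{i-1}+\dots+\varphi_p\log g_{i-p}+\varepsilon_i,\qquad i\in\mathbb Z,$$ where the $\varepsilon_i$ are i.i.d. with mean zero and finite variance, and $1-\varphi_1z-\dots-\varphi_pz^p\neq0$ for all complex $z$ with $|z|\le1$. For $i\in\mathbb Z$ and $t\in[0,1]$ let $$R_i(t)=g_i\int_0^t\sigma(u)\,dW_i(u)\quad\text{a.s.},$$ with the integral an Itô integral. Put $G(t)=\int_0^t\sigma^2(u)\,du$ and $H(t)=\log G(t)$. For integers $N,m\ge1$ put $\Delta=1/m$, $t_k=k\Delta$, $$\widehat Q_i(t)=\sum_{k=1}^m|R_i(t_k)-R_i(t_{k-1})|^2\,\mathbb 1\{t_k\le t\},\qquad \widehat H(t)=\frac1N\sum_{i=1}^N\log\widehat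 Q_i(t),\qquad \widehat G(t)=\exp\widehat H(t).$$ Fix $0<\alpha<1$. Then, for every $m$ with $\Delta\le\alpha$ and every $i$, almost surely $\widehat Q_i(t)>0$ for all $t\in[\alpha,1]$ (so the logarithms are well defined there), the supremum below is measurable with respect to the completed $\sigma$-algebra, and: (i) there is a constant $C$ such that for all $N\ge1$ and all $m$ with $\Delta\le\alpha$, $$\mathbb E\sup_{t\in[\alpha,1]}|\widehat H(t)-H(t)|\le C\,(N^{-1/2}+\Delta^{1/2});$$ (ii) $\sup_{t\in[\alpha,1]}|\widehat G(t)-G(t)|=O_P(N^{-1/2}+\Delta^{1/2})$: for every $\delta>0$ there is $K$ such that for all $N\ge1$ and all $m$ with $\Delta\le\alpha$, $$\mathbb P\Big(\sup_{t\in[\alpha,1]}|\widehat G(t)-G(t)|>K\,(N^{-1/2}+\Delta^{1/2})\Big)\le\delta.$$ -/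

import Mathlib

open MeasureTheory ProbabilityTheory Filter Set
open scoped NNReal ENNReal Topology

namespace FunctionalSV

/-- A deterministic step function `∑_{k < n} c k * 1_{(τ k, τ (k+1)]}` on `[0, ∞)`. -/
structure StepFun where
  n : ℕ
  τ : ℕ → ℝ≥0
  mono : Monotone τ
  c : ℕ → ℝ

/-- The values of a step function. -/
noncomputable def StepFun.toFun (s : StepFun) (u : ℝ) : ℝ :=
  ∑ k ∈ Finset.range s.n,
    s.c k * (Ioc (s.τ k : ℝ) (s.τ (k + 1) : ℝ)).indicator (fun _ => (1 : ℝ)) u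

/-- The elementary stochastic integral `∑_{k < n} c k * (W (τ (k+1)) - W (τ k))`. -/
def StepFun.integral {Ω : Type*} (s : StepFun) (W : ℝ≥0 → Ω → ℝ) (ω : Ω) : ℝ :=
  ∑ k ∈ Finset.range s.n, s.c k * (W (s.τ (k + 1)) ω - W (s.τ k) ω)

/-- `J` is (a version of) the Itô integral `∫_0^t f(u) dW(u)` of the deterministic integrand `f`:
there are step functions `s n → f 1_{(0,t]}` in `L²(ℝ)` whose elementary stochastic integrals
converge to `J` in `L²(P)`. By the Itô isometry, `J` is unique up to `P`-null sets and does not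
depend on the approximating sequence. -/
def IsItoIntegral {Ω : Type*} [MeasurableSpace Ω] (W : ℝ≥0 → Ω → ℝ) (f : ℝ → ℝ) (t : ℝ)
    (P : Measure Ω) (J : Ω → ℝ) : Prop :=
  AEStronglyMeasurable J P ∧
  ∃ s : ℕ → StepFun,
    Tendsto (fun n => eLpNorm (fun u => (Ioc 0 t).indicator f u - (s n).toFun u) 2 volume)
      atTop (𝓝 0) ∧
    Tendsto (fun n => eLpNorm (fun ω => J ω - (s n).integral W ω) 2 P) atTop (𝓝 0)

/-- Strict stationarity of a real sequence indexed by `ℤ`: for every `h`, the shifted sequence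
`(x_{i+h})_i` has the same law on `ℝ^ℤ` as `(x_i)_i`. -/
def IsStrictlyStationary {Ω : Type*} [MeasurableSpace Ω] (x : ℤ → Ω → ℝ) (P : Measure Ω) : Prop :=
  ∀ h : ℤ, IdentDistrib (fun ω (i : ℤ) => x (i + h) ω) (fun ω (i : ℤ) => x i ω) P P

/-- Independent identically distributed noise with mean zero and finite second moment. -/
structure IsIIDWhiteNoise {Ω : Type*} [MeasurableSpace Ω] (ε : ℤ → Ω → ℝ) (P : Measure Ω) :
    Prop where
  indep : iIndepFun ε P
  identDistrib : ∀ i, IdentDistrib (ε i) (ε 0) P P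
  memLp : ∀ i, MemLp (ε i) 2 P
  mean_zero : ∀ i, ∫ ω, ε i ω ∂P = 0

/-- The autoregressive polynomial `1 - φ₁ z - ⋯ - φ_p z^p` has no zero in the closed unit disk
(`φ j` is the coefficient of lag `j + 1`). -/
def IsCausalPolynomial {p : ℕ} (φ : Fin p → ℝ) : Prop :=
  ∀ z : ℂ, ‖z‖ ≤ 1 → 1 - ∑ j : Fin p, (φ j : ℂ) * z ^ ((j : ℕ) + 1) ≠ 0

/-- `x` solves the AR(p) equation `x_i = φ₁ x_{i-1} + ⋯ + φ_p x_{i-p} + ε_i` for all `i ∈ ℤ`. -/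
def SolvesAR {Ω : Type*} [MeasurableSpace Ω] {p : ℕ} (φ : Fin p → ℝ) (x ε : ℤ → Ω → ℝ)
    (P : Measure Ω) : Prop :=
  ∀ i : ℤ, ∀ᵐ ω ∂P, x i ω = ∑ j : Fin p, φ j * x (i - ((j : ℕ) + 1 : ℤ)) ω + ε i ω

/-- Cumulative volatility `G(t) = ∫_0^t σ²(u) du`. -/
noncomputable def G (σ : ℝ → ℝ) (t : ℝ) : ℝ := ∫ u in (0 : ℝ)..t, σ u ^ 2

/-- `H(t) = log G(t)`. -/
noncomputable def H (σ : ℝ → ℝ) (t : ℝ) : ℝ := Real.log (G σ t)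

/-- Realized quadratic variation of one path `r` observed at `t_k = k / m`, `k = 0, …, m`:
`∑_{k=1}^m |r(t_k) - r(t_{k-1})|² 1{t_k ≤ t}`. -/
noncomputable def realizedQV (m : ℕ) (r : ℝ → ℝ) (t : ℝ) : ℝ :=
  ∑ k ∈ Finset.range m,
    if ((k : ℝ) + 1) / m ≤ t then |r (((k : ℝ) + 1) / m) - r ((k : ℝ) / m)| ^ 2 else 0

/-- `Ĥ(t) = N⁻¹ ∑_{i=1}^N log Q̂_i(t)`. -/
noncomputable def Hhat {Ω : Type*} (R : ℤ → ℝ → Ω → ℝ) (N m : ℕ) (t : ℝ) (ω : Ω) : ℝ :=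
  (1 / (N : ℝ)) * ∑ i ∈ Finset.Icc 1 N, Real.log (realizedQV m (fun s => R (i : ℤ) s ω) t)

/-- `Ĝ(t) = exp Ĥ(t)`. -/
noncomputable def Ghat {Ω : Type*} (R : ℤ → ℝ → Ω → ℝ) (N m : ℕ) (t : ℝ) (ω : Ω) : ℝ :=
  Real.exp (Hhat R N m t ω)

/-- `sup_{t ∈ [α, 1]} |f(t)|`, with values in `[0, ∞]`. -/
noncomputable def supAbs (α : ℝ) (f : ℝ → ℝ) : ℝ≥0∞ :=
  ⨆ t ∈ Icc α 1, ENNReal.ofReal |f t|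

/-- The rate `N^{-1/2} + Δ^{1/2}` with `Δ = 1 / m`. -/
noncomputable def rate (N m : ℕ) : ℝ :=
  (N : ℝ) ^ (-(1 / 2) : ℝ) + (1 / (m : ℝ)) ^ (1 / 2 : ℝ)

end FunctionalSV

/-!
On the grid `t_k = k / m` the realized variance of the `i`-th path factors as
`Q̂_i(t) = g_i² S_i(⌊m t⌋)`, where `S_i(k) = ∑_{j < k} D_j²` and the increments `D_j` of
`∫ σ dW_i` are independent centred Gaussian variables whose variances `v_j = O(Δ)` sum to
`V(k) = G(t_k)` (`exists_gaussian_increments`). Hence `Ĥ - H` is the average over `i` of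
`2 log g_i` plus the average of `log S_i(⌊m t⌋) - H(t)`, and the two averages are estimated
separately.

*The volatility level.* The autoregressive polynomial splits over `ℂ` into factors `L - r` with
`|r| > 1`, where `L` is the backshift. Inverting one factor keeps a sequence that is bounded in
probability bounded in `L¹` (`exists_lintegral_le_of_root`), so a stationary solution is integrable.
Summing the recursion over `1 ≤ i ≤ N` then gives
`(1 - φ₁ - ⋯ - φ_p) ∑ log g_i = ∑ ε_i + O_{L¹}(1)`, which is `O(√N)` in `L¹`
(`exists_integral_abs_sum_le`).

*The realized variance.* The error of a single path is already `O(Δ^{1/2})` in `L¹`, so no averaging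
over paths is needed. The process `S - V` is a sum of independent centred variables with total
variance `O(Δ)`, and Doob's `L²` inequality controls its maximum (`exists_maximal_bound`). Where
`S(⌊m α⌋)` is at least half of the lower bound `c = G(α / 2)` of `V(⌊m α⌋)`, the logarithm is
Lipschitz on the relevant range. The complementary event has probability
`O(Δ)`; there `log S` is trapped between its values at both ends of `[α, 1]`, and these have second
moments bounded uniformly in `m`, because `log (S / V)` is the logarithm of a weighted mean of
squared standard normal variables, to which Jensen's inequality applies
(`integral_log_ratio_sq_le`, `exists_log_error_bound`, `exists_path_bound`).

The rate for `Ĝ = exp Ĥ` follows from Markov's inequality, and the supremum is measurable because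
`Ĥ - H` is right-continuous in `t`.
-/

namespace FunctionalSV

section WienerIntegral

/-! ### Wiener integrals of deterministic functions -/

/-- The step function `∑ b_t 1_{(0,t]}` attached to finitely supported coefficients `b`. -/
noncomputable def stepSum : (ℝ≥0 →₀ ℝ) →ₗ[ℝ] (ℝ → ℝ) :=
  Finsupp.linearCombination ℝ fun t : ℝ≥0 => (Ioc (0 : ℝ) t).indicator fun _ => (1 : ℝ)

/-- The elementary stochastic integral `∑ b_t W_t` of `stepSum b`. -/
noncomputable def wienerSum {Ω : Type*} (W : ℝ≥0 → Ω → ℝ) : (ℝ≥0 →₀ ℝ) →ₗ[ℝ] (Ω → ℝ) :=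
  Finsupp.linearCombination ℝ W

lemma stepSum_apply (b : ℝ≥0 →₀ ℝ) (u : ℝ) :
    stepSum b u = ∑ t ∈ b.support, b t * (Ioc (0 : ℝ) t).indicator (fun _ => (1 : ℝ)) u := by
  simp [stepSum, Finsupp.linearCombination_apply, Finsupp.sum]

lemma wienerSum_apply {Ω : Type*} (W : ℝ≥0 → Ω → ℝ) (b : ℝ≥0 →₀ ℝ) (ω : Ω) :
    wienerSum W b ω = ∑ t ∈ b.support, b t * W t ω := by
  simp [wienerSum, Finsupp.linearCombination_apply, Finsupp.sum]

/-- The coefficients of a step function in the basis `1_{(0,t]}`. -/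
noncomputable def StepFun.coeffs (s : StepFun) : ℝ≥0 →₀ ℝ :=
  ∑ k ∈ Finset.range s.n,
    s.c k • (Finsupp.single (s.τ (k + 1)) (1 : ℝ) - Finsupp.single (s.τ k) 1)

lemma StepFun.stepSum_coeffs (s : StepFun) : stepSum s.coeffs = s.toFun := by
  funext u
  simp only [coeffs, map_sum, map_smul, map_sub, stepSum, Finsupp.linearCombination_single,
    Finset.sum_apply, Pi.smul_apply, Pi.sub_apply, smul_eq_mul, one_mul, toFun]
  refine Finset.sum_congr rfl fun k _ => ?_
  congr 1
  have h : (s.τ k : ℝ) ≤ s.τ (k + 1) := by exact_mod_cast s.mono (Nat.le_succ k)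
  have h0 : (0 : ℝ) ≤ s.τ k := (s.τ k).2
  simp only [Set.indicator_apply, Set.mem_Ioc]
  split_ifs <;> grind

lemma StepFun.wienerSum_coeffs {Ω : Type*} (s : StepFun) (W : ℝ≥0 → Ω → ℝ) :
    wienerSum W s.coeffs = s.integral W := by
  funext ω
  simp [coeffs, wienerSum, StepFun.integral, Finset.sum_apply]

lemma memLp_stepSum (b : ℝ≥0 →₀ ℝ) : MemLp (stepSum b) 2 volume := by
  have : stepSum b = fun u => ∑ t ∈ b.support,
      b t * (Ioc (0 : ℝ) t).indicator (fun _ => (1 : ℝ)) u := funext (stepSum_apply b)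
  rw [this]
  refine memLp_finsetSum _ fun t _ => MemLp.const_mul ?_ _
  exact memLp_indicator_const 2 measurableSet_Ioc 1 (Or.inr (by simp))

lemma integral_stepSum_sq (b : ℝ≥0 →₀ ℝ) :
    ∫ u, stepSum b u ^ 2 =
      ∑ s ∈ b.support, ∑ t ∈ b.support, b s * (b t * ((min s t : ℝ≥0) : ℝ)) := by
  have hint : ∀ s t : ℝ≥0, Integrable (fun u : ℝ => b s * (b t *
      (Ioc (0 : ℝ) (min s t : ℝ≥0)).indicator (fun _ => (1 : ℝ)) u)) := fun s t =>
    ((((integrable_indicator_iff measurableSet_Ioc).2 (by simp)).const_mul _).const_mul _)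
  have : (fun u => stepSum b u ^ 2) = fun u => ∑ s ∈ b.support, ∑ t ∈ b.support, b s * (b t *
      (Ioc (0 : ℝ) (min s t : ℝ≥0)).indicator (fun _ => (1 : ℝ)) u) := by
    funext u
    rw [stepSum_apply, sq, Finset.sum_mul_sum]
    refine Finset.sum_congr rfl fun s _ => Finset.sum_congr rfl fun t _ => ?_
    simp only [Set.indicator_apply, Set.mem_Ioc, NNReal.coe_min, le_min_iff]
    split_ifs <;> grind
  rw [this, integral_finsetSum _ fun s _ => integrable_finsetSum _ fun t _ => hint s t]
  refine Finset.sum_congr rfl fun s _ => ?_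
  rw [integral_finsetSum _ fun t _ => hint s t]
  refine Finset.sum_congr rfl fun t _ => ?_
  rw [integral_const_mul, integral_const_mul, integral_indicator_const _ measurableSet_Ioc]
  rw [Real.volume_real_Ioc_of_le (NNReal.coe_nonneg _), sub_zero, smul_eq_mul, mul_one]

variable {Ω : Type*} [MeasurableSpace Ω] {P : Measure Ω}

/-- Elementary integrals are centred Gaussian with variance given by the Itô isometry. -/
lemma hasLaw_wienerSum {W : ℝ≥0 → Ω → ℝ} (hW : IsPreBrownianReal W P) (b : ℝ≥0 →₀ ℝ) :
    HasLaw (wienerSum W b) (gaussianReal 0 (∫ u, stepSum b u ^ 2).toNNReal) P := by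
  have hG := hW.isGaussianProcess
  have := hG.isProbabilityMeasure
  have hE : wienerSum W b = fun ω => ∑ t ∈ b.support, b t * W t ω := funext (wienerSum_apply W b)
  have hg : HasGaussianLaw (wienerSum W b) P := by
    rw [hE]
    exact (hG.smul (fun t => b t)).hasGaussianLaw_fun_sum (I := b.support)
  refine ⟨hg.aemeasurable, ?_⟩
  rw [hg.map_eq_gaussianReal]
  have hL : ∀ t, MemLp (fun ω => b t * W t ω) 2 P := fun t =>
    ((hG.hasGaussianLaw_eval t).memLp_two).const_mul _
  congr 1
  · rw [hE, integral_finsetSum _ fun t _ => (hL t).integrable one_le_two]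
    refine Finset.sum_eq_zero fun t _ => ?_
    rw [integral_const_mul, hW.integral_eval, mul_zero]
  · congr 1
    rw [integral_stepSum_sq, ← covariance_self hg.aemeasurable, hE,
      covariance_fun_sum_fun_sum' (fun t _ => hL t) (fun t _ => hL t)]
    refine Finset.sum_congr rfl fun s _ => Finset.sum_congr rfl fun t _ => ?_
    rw [covariance_const_mul_left, covariance_const_mul_right, hW.covariance_fun_eval]

/-- `J` is the Wiener integral of the square integrable function `h`, that is, an `L²` limit of
elementary integrals of step functions converging to `h` in `L²`. Unlike `IsItoIntegral`, this
relation is linear in `(h, J)` by construction. -/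
def IsWienerIntegral (W : ℝ≥0 → Ω → ℝ) (P : Measure Ω) (h : ℝ → ℝ) (J : Ω → ℝ) : Prop :=
  AEStronglyMeasurable h volume ∧ AEStronglyMeasurable J P ∧ ∃ b : ℕ → ℝ≥0 →₀ ℝ,
    Tendsto (fun n => eLpNorm (h - stepSum (b n)) 2 volume) atTop (𝓝 0) ∧
    Tendsto (fun n => eLpNorm (J - wienerSum W (b n)) 2 P) atTop (𝓝 0)

lemma IsItoIntegral.isWienerIntegral {W : ℝ≥0 → Ω → ℝ} {f : ℝ → ℝ} {t : ℝ} {J : Ω → ℝ}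
    (hJ : IsItoIntegral W f t P J) (hf : Measurable f) :
    IsWienerIntegral W P ((Ioc 0 t).indicator f) J := by
  obtain ⟨hm, s, h1, h2⟩ := hJ
  refine ⟨(hf.indicator measurableSet_Ioc).aestronglyMeasurable, hm, fun n => (s n).coeffs, ?_, ?_⟩
  · simp only [StepFun.stepSum_coeffs]; exact h1
  · simp only [StepFun.wienerSum_coeffs]; exact h2

namespace IsWienerIntegral

variable {W : ℝ≥0 → Ω → ℝ} {h h' : ℝ → ℝ} {J J' : Ω → ℝ}

lemma zero : IsWienerIntegral W P 0 0 :=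
  ⟨aestronglyMeasurable_zero, aestronglyMeasurable_zero, fun _ => 0, by simp, by simp⟩

lemma smul (hJ : IsWienerIntegral W P h J) (a : ℝ) : IsWienerIntegral W P (a • h) (a • J) := by
  obtain ⟨hh, hm, b, h1, h2⟩ := hJ
  refine ⟨hh.const_smul a, hm.const_smul a, fun n => a • b n, ?_, ?_⟩
  · simp only [map_smul, ← smul_sub, eLpNorm_const_smul]
    simpa using ENNReal.Tendsto.const_mul h1 (Or.inr (by simp))
  · simp only [map_smul, ← smul_sub, eLpNorm_const_smul]
    simpa using ENNReal.Tendsto.const_mul h2 (Or.inr (by simp))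

lemma add (hW : IsPreBrownianReal W P) (hJ : IsWienerIntegral W P h J)
    (hJ' : IsWienerIntegral W P h' J') : IsWienerIntegral W P (h + h') (J + J') := by
  obtain ⟨hh, hm, b, h1, h2⟩ := hJ
  obtain ⟨hh', hm', b', h1', h2'⟩ := hJ'
  have mW : ∀ b, AEStronglyMeasurable (wienerSum W b) P := fun b =>
    (hasLaw_wienerSum hW b).aemeasurable.aestronglyMeasurable
  refine ⟨hh.add hh', hm.add hm', fun n => b n + b' n, ?_, ?_⟩
  · refine tendsto_of_tendsto_of_tendsto_of_le_of_le tendsto_const_nhds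
      (by simpa using h1.add h1') (fun _ => zero_le) fun n => ?_
    simp only [map_add, add_sub_add_comm]
    exact eLpNorm_add_le (hh.sub (memLp_stepSum _).1) (hh'.sub (memLp_stepSum _).1) one_le_two
  · refine tendsto_of_tendsto_of_tendsto_of_le_of_le tendsto_const_nhds
      (by simpa using h2.add h2') (fun _ => zero_le) fun n => ?_
    simp only [map_add, add_sub_add_comm]
    exact eLpNorm_add_le (hm.sub (mW _)) (hm'.sub (mW _)) one_le_two

lemma sub (hW : IsPreBrownianReal W P) (hJ : IsWienerIntegral W P h J)
    (hJ' : IsWienerIntegral W P h' J') : IsWienerIntegral W P (h - h') (J - J') := by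
  simpa [sub_eq_add_neg] using hJ.add hW (hJ'.smul (-1))

lemma sum (hW : IsPreBrownianReal W P) {ι : Type*} (s : Finset ι) {h : ι → ℝ → ℝ} {J : ι → Ω → ℝ}
    (hJ : ∀ i ∈ s, IsWienerIntegral W P (h i) (J i)) :
    IsWienerIntegral W P (∑ i ∈ s, h i) (∑ i ∈ s, J i) := by
  classical
  induction s using Finset.induction_on with
  | empty => simpa using zero
  | insert a s ha ih =>
    rw [Finset.sum_insert ha, Finset.sum_insert ha]
    exact (hJ a (by simp)).add hW (ih fun i hi => hJ i (by simp [hi]))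

lemma memLp (hJ : IsWienerIntegral W P h J) : MemLp h 2 volume := by
  obtain ⟨hh, -, b, h1, -⟩ := hJ
  obtain ⟨n, hn⟩ := (h1.eventually (gt_mem_nhds (zero_lt_one (α := ℝ≥0∞)))).exists
  have : MemLp (h - stepSum (b n)) 2 volume :=
    ⟨hh.sub (memLp_stepSum _).1, hn.trans ENNReal.one_lt_top⟩
  simpa using this.add (memLp_stepSum (b n))

/-- A Wiener integral is centred Gaussian with variance `∫ h²`: characteristic functions and
variances of elementary integrals pass to the `L²` limit. -/
lemma hasLaw (hW : IsPreBrownianReal W P) (hJ : IsWienerIntegral W P h J) :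
    HasLaw J (gaussianReal 0 (∫ u, h u ^ 2).toNNReal) P := by
  have := hW.isGaussianProcess.isProbabilityMeasure
  have hmem := hJ.memLp
  obtain ⟨hh, hm, b, h1, h2⟩ := hJ
  refine ⟨hm.aemeasurable, ?_⟩
  have : IsProbabilityMeasure (P.map J) := Measure.isProbabilityMeasure_map hm.aemeasurable
  have mW : ∀ b, AEStronglyMeasurable (wienerSum W b) P := fun b =>
    (hasLaw_wienerSum hW b).aemeasurable.aestronglyMeasurable
  have hvar : Tendsto (fun n => ∫ u, stepSum (b n) u ^ 2) atTop (𝓝 (∫ u, h u ^ 2)) := by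
    have hT : Tendsto (fun n => (memLp_stepSum (b n)).toLp) atTop (𝓝 hmem.toLp) := by
      rw [Lp.tendsto_Lp_iff_tendsto_eLpNorm'']
      refine h1.congr fun n => ?_
      rw [← eLpNorm_neg, neg_sub]
    have hnorm : ∀ {f : ℝ → ℝ} (hf : MemLp f 2 volume), ∫ u, f u ^ 2 = ‖hf.toLp‖ ^ 2 := by
      intro f hf
      rw [← real_inner_self_eq_norm_sq, L2.inner_def]
      refine integral_congr_ae ?_
      filter_upwards [hf.coeFn_toLp] with u hu
      rw [hu]; simp [sq]
    simp only [hnorm (memLp_stepSum _), hnorm hmem]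
    exact (hT.norm).pow 2
  refine Measure.ext_of_charFun (funext fun t => ?_)
  have hlim1 : Tendsto (fun n => charFun (P.map (wienerSum W (b n))) t) atTop
      (𝓝 (charFun (P.map J) t)) := by
    have hmeas : TendstoInMeasure P (fun n => wienerSum W (b n)) atTop J := by
      refine tendstoInMeasure_of_tendsto_eLpNorm two_ne_zero (fun n => mW _) hm ?_
      refine h2.congr fun n => ?_
      rw [← eLpNorm_neg, neg_sub]
    have hd := hmeas.tendstoInDistribution (fun n => (mW (b n)).aemeasurable)
    exact ProbabilityMeasure.tendsto_iff_tendsto_charFun.1 hd.tendsto t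
  have hlim2 : Tendsto (fun n => charFun (P.map (wienerSum W (b n))) t) atTop
      (𝓝 (charFun (gaussianReal 0 (∫ u, h u ^ 2).toNNReal) t)) := by
    simp only [(hasLaw_wienerSum hW _).map_eq, charFun_gaussianReal]
    have : Tendsto (fun n => ((((∫ u, stepSum (b n) u ^ 2).toNNReal : ℝ≥0) : ℝ) : ℂ)) atTop
        (𝓝 ((((∫ u, h u ^ 2).toNNReal : ℝ≥0) : ℝ) : ℂ)) :=
      (Complex.continuous_ofReal.tendsto _).comp ((NNReal.continuous_coe.tendsto _).comp
        ((continuous_real_toNNReal.tendsto _).comp hvar))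
    exact (Complex.continuous_exp.tendsto _).comp
      (tendsto_const_nhds.sub ((this.mul tendsto_const_nhds).div_const _))
  exact tendsto_nhds_unique hlim1 hlim2

/-- Wiener integrals of functions with pairwise disjoint supports are independent: the joint
characteristic function factors, since every linear combination is Gaussian and
`∫ (∑ a_i h_i)² = ∑ a_i² ∫ h_i²`. -/
lemma iIndepFun_of_fintype (hW : IsPreBrownianReal W P) {ι : Type*} [Fintype ι] {h : ι → ℝ → ℝ}
    {J : ι → Ω → ℝ} (hJ : ∀ i, IsWienerIntegral W P (h i) (J i))
    (hd : ∀ i j, i ≠ j → ∀ u, h i u * h j u = 0) : ProbabilityTheory.iIndepFun J P := by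
  classical
  have := hW.isGaussianProcess.isProbabilityMeasure
  have hJm : ∀ i, AEMeasurable (J i) P := fun i => ((hJ i).hasLaw hW).aemeasurable
  rw [iIndepFun_iff_charFun_pi hJm]
  intro t
  have hT := sum hW Finset.univ fun i _ => (hJ i).smul (t i)
  have h1 : charFun (P.map fun ω => WithLp.toLp 2 (J · ω)) t
      = charFun (P.map (∑ i, t i • J i)) 1 := by
    rw [charFun_apply, integral_map (by fun_prop) (by fun_prop), charFun_apply_real,
      integral_map hT.2.1.aemeasurable (by fun_prop)]
    refine integral_congr_ae (ae_of_all _ fun ω => ?_)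
    simp [PiLp.inner_apply, mul_comm]
  have hsq : ∫ u, (∑ i, t i • h i) u ^ 2 = ∑ i, t i ^ 2 * ∫ u, h i u ^ 2 := by
    have : (fun u => (∑ i, t i • h i) u ^ 2) = fun u => ∑ i, t i ^ 2 * h i u ^ 2 := by
      funext u
      rw [Finset.sum_apply, sq, Finset.sum_mul_sum]
      refine Finset.sum_congr rfl fun i _ => ?_
      rw [Finset.sum_eq_single i]
      · simp only [Pi.smul_apply, smul_eq_mul]; ring
      · intro j _ hj
        have := hd i j (Ne.symm hj) u
        simp only [Pi.smul_apply, smul_eq_mul]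
        linear_combination t i * t j * this
      · simp
    rw [this, integral_finsetSum _ fun i _ => ((hJ i).memLp.integrable_sq).const_mul _]
    simp [integral_const_mul]
  rw [h1, (hT.hasLaw hW).map_eq, charFun_gaussianReal, hsq,
    Real.coe_toNNReal _ (Finset.sum_nonneg fun i _ =>
      mul_nonneg (sq_nonneg _) (integral_nonneg fun _ => sq_nonneg _))]
  simp only [((hJ _).hasLaw hW).map_eq, charFun_gaussianReal]
  rw [← Complex.exp_sum]
  congr 1
  simp only [Real.coe_toNNReal _ (integral_nonneg fun u => sq_nonneg (h _ u))]
  push_cast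
  simp only [mul_zero, zero_mul, zero_sub, one_pow, mul_one]
  rw [Finset.sum_div, ← Finset.sum_neg_distrib]
  exact Finset.sum_congr rfl fun i _ => by ring

lemma iIndepFun (hW : IsPreBrownianReal W P) {ι : Type*} {h : ι → ℝ → ℝ} {J : ι → Ω → ℝ}
    (hJ : ∀ i, IsWienerIntegral W P (h i) (J i))
    (hd : ∀ i j, i ≠ j → ∀ u, h i u * h j u = 0) : ProbabilityTheory.iIndepFun J P := by
  rw [iIndepFun_iff_finset]
  intro s
  exact iIndepFun_of_fintype hW (h := fun i : s => h i) (fun i => hJ i)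
    fun i j hij => hd i j (fun h => hij (Subtype.ext h))

end IsWienerIntegral

end WienerIntegral

section MaximalInequality

/-! ### A maximal inequality for sums of independent variables -/

/-- Running maximum `max (0, x 0, x 0 + x 1, …, x 0 + ⋯ + x (n - 1))` of the partial sums. -/
noncomputable def runMax (x : ℕ → ℝ) : ℕ → ℝ
  | 0 => 0
  | n + 1 => max (runMax x n) (∑ j ∈ Finset.range (n + 1), x j)

lemma runMax_congr {x y : ℕ → ℝ} {n : ℕ} (h : ∀ j < n, x j = y j) : runMax x n = runMax y n := by
  induction n with
  | zero => rfl
  | succ n ih =>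
    rw [runMax, runMax, ih fun j hj => h j (by omega),
      Finset.sum_congr rfl fun j hj => h j (Finset.mem_range.1 hj)]

lemma sum_le_runMax (x : ℕ → ℝ) {k n : ℕ} (hk : k ≤ n) :
    ∑ j ∈ Finset.range k, x j ≤ runMax x n := by
  induction n with
  | zero => simp [Nat.le_zero.1 hk, runMax]
  | succ n ih =>
    rcases hk.lt_or_eq with h | rfl
    · exact (ih (by omega)).trans (le_max_left _ _)
    · exact le_max_right _ _

lemma measurable_runMax (n : ℕ) : Measurable fun x : ℕ → ℝ => runMax x n := by
  induction n with
  | zero => exact measurable_const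
  | succ n ih =>
    simp only [runMax]
    exact ih.max (Finset.measurable_sum _ fun j _ => measurable_pi_apply j)

/-- Pathwise form of Doob's `L²` inequality: up to the martingale transform `∑ A_i x_i`, the square
of the running maximum `A_n` is controlled by the last partial sum. -/
lemma runMax_sq_le (x : ℕ → ℝ) (n : ℕ) :
    runMax x n ^ 2 ≤ 2 * runMax x n * (∑ j ∈ Finset.range n, x j)
      - 2 * ∑ i ∈ Finset.range n, runMax x i * x i := by
  induction n with
  | zero => simp [runMax]
  | succ n ih =>
    rw [Finset.sum_range_succ _ n, Finset.sum_range_succ (fun i => runMax x i * x i), runMax,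
      Finset.sum_range_succ]
    rcases max_choice (runMax x n) (∑ j ∈ Finset.range n, x j + x n) with h | h
    · rw [h]; nlinarith
    · rw [h]; nlinarith [sq_nonneg (∑ j ∈ Finset.range n, x j + x n - runMax x n)]

variable {Ω : Type*} [MeasurableSpace Ω] {P : Measure Ω}

lemma memLp_runMax {X : ℕ → Ω → ℝ} (hX : ∀ j, MemLp (X j) 2 P) (n : ℕ) :
    MemLp (fun ω => runMax (fun j => X j ω) n) 2 P := by
  induction n with
  | zero => simp [runMax]
  | succ n ih =>
    simp only [runMax]
    exact ih.sup (memLp_finsetSum _ fun j _ => hX j)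

lemma integral_runMax_mul_eq_zero {X : ℕ → Ω → ℝ} (hX : ∀ j, MemLp (X j) 2 P)
    (hind : iIndepFun X P) (h0 : ∀ j, ∫ ω, X j ω ∂P = 0) (n : ℕ) :
    ∫ ω, runMax (fun j => X j ω) n * X n ω ∂P = 0 := by
  have hm : ∀ j, AEMeasurable (X j) P := fun j => (hX j).aestronglyMeasurable.aemeasurable
  have h := hind.indepFun_finset₀ (Finset.range n) {n} (by simp) hm
  -- extension of a finite tuple by zero, so that `runMax` can be evaluated on it
  let ext : (Finset.range n → ℝ) → ℕ → ℝ := fun y j =>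
    if h : j ∈ Finset.range n then y ⟨j, h⟩ else 0
  have hext : Measurable ext := measurable_pi_lambda _ fun j => by
    by_cases hj : j ∈ Finset.range n
    · simp only [ext, hj, dite_true]; exact measurable_pi_apply _
    · simp only [ext, hj, dite_false]; exact measurable_const
  have h' := h.comp ((measurable_runMax n).comp hext)
    (measurable_pi_apply (⟨n, by simp⟩ : ({n} : Finset ℕ)))
  have h'' : IndepFun (fun ω => runMax (fun j => X j ω) n) (X n) P := by
    refine h'.congr (ae_of_all _ fun ω => ?_) (ae_of_all _ fun ω => rfl)
    refine runMax_congr fun j hj => ?_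
    simp only [ext, Finset.mem_range.2 hj, dite_true]
  rw [h''.integral_fun_mul_eq_mul_integral (memLp_runMax hX n).aestronglyMeasurable
    (hX n).aestronglyMeasurable, h0, mul_zero]

variable [IsProbabilityMeasure P]

lemma integral_sum_sq_of_iIndepFun {ι : Type*} {X : ι → Ω → ℝ} (hX : ∀ j, MemLp (X j) 2 P)
    (hind : iIndepFun X P) (h0 : ∀ j, ∫ ω, X j ω ∂P = 0) (s : Finset ι) :
    ∫ ω, (∑ j ∈ s, X j ω) ^ 2 ∂P = ∑ j ∈ s, ∫ ω, X j ω ^ 2 ∂P := by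
  have hv := IndepFun.variance_sum (μ := P) (X := X) (s := s) (fun i _ => hX i)
    fun i _ j _ hij => hind.indepFun hij
  rw [variance_of_integral_eq_zero] at hv
  · rw [show (∑ i ∈ s, X i) = fun ω => ∑ i ∈ s, X i ω from by ext; simp] at hv
    rw [hv]
    exact Finset.sum_congr rfl fun j _ =>
      variance_of_integral_eq_zero (hX j).aestronglyMeasurable.aemeasurable (h0 j)
  · exact (memLp_finsetSum' s fun j _ => hX j).aestronglyMeasurable.aemeasurable
  · simp only [Finset.sum_apply]
    rw [integral_finsetSum _ fun j _ => (hX j).integrable one_le_two]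
    exact Finset.sum_eq_zero fun j _ => h0 j

lemma integral_runMax_sq_le {X : ℕ → Ω → ℝ} (hX : ∀ j, MemLp (X j) 2 P)
    (hind : iIndepFun X P) (h0 : ∀ j, ∫ ω, X j ω ∂P = 0) (n : ℕ) :
    ∫ ω, runMax (fun j => X j ω) n ^ 2 ∂P ≤ 4 * ∑ j ∈ Finset.range n, ∫ ω, X j ω ^ 2 ∂P := by
  rw [← integral_sum_sq_of_iIndepFun hX hind h0, ← integral_const_mul]
  have hA := fun n => memLp_runMax hX n
  have hM : MemLp (fun ω => ∑ j ∈ Finset.range n, X j ω) 2 P := memLp_finsetSum _ fun j _ => hX j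
  have hT : ∀ i, Integrable (fun ω => runMax (fun j => X j ω) i * X i ω) P := fun i =>
    (hA i).integrable_mul (hX i)
  have h1 : ∫ ω, runMax (fun j => X j ω) n ^ 2 ∂P ≤
      ∫ ω, (4 * (∑ j ∈ Finset.range n, X j ω) ^ 2
        - 4 * ∑ i ∈ Finset.range n, runMax (fun j => X j ω) i * X i ω) ∂P := by
    refine integral_mono (hA n).integrable_sq ((hM.integrable_sq.const_mul _).sub
      ((integrable_finsetSum _ fun i _ => hT i).const_mul _)) fun ω => ?_
    have := runMax_sq_le (fun j => X j ω) n
    have := sq_nonneg (runMax (fun j => X j ω) n - 2 * ∑ j ∈ Finset.range n, X j ω)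
    simp only
    nlinarith
  rw [integral_sub (hM.integrable_sq.const_mul _)
      ((integrable_finsetSum _ fun i _ => hT i).const_mul _), integral_const_mul 4
      (fun ω => ∑ i ∈ Finset.range n, runMax (fun j => X j ω) i * X i ω),
    integral_finsetSum _ fun i _ => hT i,
    Finset.sum_eq_zero fun i _ => integral_runMax_mul_eq_zero hX hind h0 i] at h1
  simpa using h1

/-- **Kolmogorov–Doob `L²` maximal inequality** for sums of independent centred variables. -/
lemma exists_maximal_bound {X : ℕ → Ω → ℝ} (hX : ∀ j, MemLp (X j) 2 P)
    (hind : iIndepFun X P) (h0 : ∀ j, ∫ ω, X j ω ∂P = 0) (n : ℕ) :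
    ∃ Z : Ω → ℝ, MemLp Z 2 P ∧ (∀ ω, ∀ k ≤ n, |∑ j ∈ Finset.range k, X j ω| ≤ Z ω) ∧
      ∫ ω, Z ω ^ 2 ∂P ≤ 8 * ∑ j ∈ Finset.range n, ∫ ω, X j ω ^ 2 ∂P := by
  have hX' : ∀ j, MemLp (fun ω => - X j ω) 2 P := fun j => (hX j).neg
  have hind' : iIndepFun (fun j ω => - X j ω) P :=
    hind.comp (fun _ x => -x) fun _ => measurable_neg
  have h0' : ∀ j, ∫ ω, - X j ω ∂P = 0 := fun j => by rw [integral_neg, h0, neg_zero]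
  refine ⟨fun ω => max (runMax (fun j => X j ω) n) (runMax (fun j => - X j ω) n),
    (memLp_runMax hX n).sup (memLp_runMax hX' n), fun ω k hk => ?_, ?_⟩
  · rw [abs_le']
    refine ⟨(sum_le_runMax _ hk).trans (le_max_left _ _), ?_⟩
    rw [← Finset.sum_neg_distrib]
    exact (sum_le_runMax (fun j => - X j ω) hk).trans (le_max_right _ _)
  · have h1 := integral_runMax_sq_le hX hind h0 n
    have h2 := integral_runMax_sq_le hX' hind' h0' n
    simp only [neg_sq] at h2
    calc _ ≤ ∫ ω, (runMax (fun j => X j ω) n ^ 2 + runMax (fun j => - X j ω) n ^ 2) ∂P := by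
          refine integral_mono
            ((memLp_runMax hX n).sup (memLp_runMax hX' n)).integrable_sq
            ((memLp_runMax hX n).integrable_sq.add (memLp_runMax hX' n).integrable_sq) fun ω => ?_
          rcases max_choice (runMax (fun j => X j ω) n) (runMax (fun j => - X j ω) n) with h | h <;>
          · simp only [h]; nlinarith [sq_nonneg (runMax (fun j => X j ω) n),
              sq_nonneg (runMax (fun j => - X j ω) n)]
      _ ≤ _ := by
          rw [integral_add (memLp_runMax hX n).integrable_sq (memLp_runMax hX' n).integrable_sq]
          linarith

end MaximalInequality

section LogMoments

/-! ### Logarithmic moments of Gaussian quadratic forms -/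

lemma log_sq_le_four_mul {y : ℝ} (hy : 1 ≤ y) : Real.log y ^ 2 ≤ 4 * y := by
  have h0 := Real.log_nonneg hy
  have h := Real.log_le_rpow_div (zero_le_one.trans hy) (ε := 1 / 2) (by norm_num)
  have h2 : (y ^ (1 / 2 : ℝ)) ^ 2 = y := by
    rw [← Real.rpow_natCast, ← Real.rpow_mul (by linarith)]; norm_num
  nlinarith [Real.rpow_nonneg (zero_le_one.trans hy) (1 / 2)]

lemma log_sq_le_rpow {y : ℝ} (hy : 0 < y) : Real.log y ^ 2 ≤ 4 * y + 64 * y ^ (-(1 / 4) : ℝ) := by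
  have hp : 0 ≤ y ^ (-(1 / 4) : ℝ) := Real.rpow_nonneg hy.le _
  rcases le_total 1 y with h | h
  · linarith [log_sq_le_four_mul h]
  · have h1 : 1 ≤ y⁻¹ := (one_le_inv₀ hy).2 h
    have h0 := Real.log_nonneg h1
    have h2 := Real.log_le_rpow_div (inv_nonneg.2 hy.le) (ε := 1 / 8) (by norm_num)
    have h3 : (y⁻¹ ^ (1 / 8 : ℝ)) ^ 2 = y ^ (-(1 / 4) : ℝ) := by
      rw [← Real.rpow_natCast, ← Real.rpow_mul (by positivity), Real.inv_rpow hy.le,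
        ← Real.rpow_neg hy.le]; norm_num
    have h4 : Real.log y ^ 2 = Real.log y⁻¹ ^ 2 := by rw [Real.log_inv, neg_sq]
    nlinarith [Real.rpow_nonneg (inv_nonneg.2 hy.le) (1 / 8)]

/-- Jensen's inequality for the squared logarithm: the negative part of `log` is convex, and its
positive part is `O(√y)`. -/
lemma log_sum_sq_le {ι : Type*} (s : Finset ι) {w z : ι → ℝ} (hw : ∀ i ∈ s, 0 ≤ w i)
    (hw1 : ∑ i ∈ s, w i = 1) (hz : ∀ i ∈ s, 0 < z i) :
    Real.log (∑ i ∈ s, w i * z i) ^ 2 ≤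
      4 * (∑ i ∈ s, w i * z i) + ∑ i ∈ s, w i * Real.log (z i) ^ 2 := by
  have hsum : 0 ≤ ∑ i ∈ s, w i * Real.log (z i) ^ 2 :=
    Finset.sum_nonneg fun i hi => mul_nonneg (hw i hi) (sq_nonneg _)
  have hsum' : 0 ≤ ∑ i ∈ s, w i * z i :=
    Finset.sum_nonneg fun i hi => mul_nonneg (hw i hi) (hz i hi).le
  rcases le_total 1 (∑ i ∈ s, w i * z i) with h | h
  · linarith [log_sq_le_four_mul h]
  · have h1 := strictConcaveOn_log_Ioi.concaveOn.le_map_sum hw hw1 hz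
    have h2 := (even_two.convexOn_pow (𝕜 := ℝ)).map_sum_le hw hw1
      (p := fun i => Real.log (z i)) fun _ _ => mem_univ _
    simp only [smul_eq_mul] at h1 h2
    have h3 := Real.log_nonpos hsum' h
    nlinarith

lemma abs_log_sub_log_le {a x y : ℝ} (ha : 0 < a) (hx : a ≤ x) (hy : a ≤ y) :
    |Real.log x - Real.log y| ≤ |x - y| / a := by
  have key : ∀ {x y : ℝ}, a ≤ x → a ≤ y → Real.log x - Real.log y ≤ |x - y| / a := by
    intro x y hx hy
    have hx0 := ha.trans_le hx
    have hy0 := ha.trans_le hy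
    rw [← Real.log_div hx0.ne' hy0.ne']
    calc Real.log (x / y) ≤ x / y - 1 := Real.log_le_sub_one_of_pos (by positivity)
      _ = (x - y) / y := by field_simp
      _ ≤ |x - y| / y := by gcongr; exact le_abs_self _
      _ ≤ |x - y| / a := by gcongr
  rw [abs_le']
  refine ⟨key hx hy, ?_⟩
  rw [neg_sub, abs_sub_comm]
  exact key hy hx

/-- The second moment of `log ξ²` for a standard normal variable `ξ`. -/
noncomputable def gaussianLogMoment : ℝ := ∫ x, Real.log (x ^ 2) ^ 2 ∂gaussianReal 0 1

/-- The variance of `ξ²` for a standard normal variable `ξ`. -/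
noncomputable def gaussianSqVar : ℝ := ∫ x, (x ^ 2 - 1) ^ 2 ∂gaussianReal 0 1

lemma gaussianSqVar_nonneg : 0 ≤ gaussianSqVar := integral_nonneg fun _ => sq_nonneg _

lemma integrable_rpow_gaussianReal :
    Integrable (fun x : ℝ => (x ^ 2) ^ (-(1 / 4) : ℝ)) (gaussianReal 0 1) := by
  rw [gaussianReal_of_var_ne_zero 0 one_ne_zero, integrable_withDensity_iff_integrable_smul'
    (measurable_gaussianPDF 0 1) (ae_of_all _ fun _ => gaussianPDF_lt_top)]
  have h : IntegrableOn (fun x : ℝ => x ^ (-(1 / 2) : ℝ) * Real.exp (-(1 / 2) * x ^ 2)) (Ioi 0) :=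
    integrableOn_rpow_mul_exp_neg_mul_sq (by norm_num) (by norm_num)
  have h2 : Integrable (fun x : ℝ => |x| ^ (-(1 / 2) : ℝ) * Real.exp (-(1 / 2) * |x| ^ 2)) := by
    have h3 : IntegrableOn (fun x : ℝ => |x| ^ (-(1 / 2) : ℝ) * Real.exp (-(1 / 2) * |x| ^ 2))
        (Ioi 0) := h.congr_fun (fun x hx => by simp only [abs_of_pos (mem_Ioi.1 hx)])
          measurableSet_Ioi
    have h4 := h3.comp_neg
    simp only [abs_neg, Set.neg_Ioi, neg_zero] at h4
    rw [← integrableOn_univ, ← Iio_union_Ici (a := (0 : ℝ)), integrableOn_union,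
      integrableOn_Ici_iff_integrableOn_Ioi]
    exact ⟨h4, h3⟩
  refine (h2.const_mul ((√(2 * Real.pi))⁻¹)).congr (ae_of_all _ fun x => ?_)
  have e : (x ^ 2) ^ (-(1 / 4) : ℝ) = |x| ^ (-(1 / 2) : ℝ) := by
    rw [← sq_abs, ← Real.rpow_natCast, ← Real.rpow_mul (abs_nonneg x)]; norm_num
  simp only [toReal_gaussianPDF, gaussianPDFReal, e, smul_eq_mul, sq_abs]
  simp only [NNReal.coe_one, mul_one, sub_zero]
  ring_nf

lemma integrable_log_sq_gaussianReal :
    Integrable (fun x : ℝ => Real.log (x ^ 2) ^ 2) (gaussianReal 0 1) := by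
  have hsq : Integrable (fun x : ℝ => x ^ 2) (gaussianReal 0 1) :=
    (memLp_id_gaussianReal 2).integrable_sq
  refine ((hsq.const_mul 4).add (integrable_rpow_gaussianReal.const_mul 64)).mono'
    ((Real.measurable_log.comp (measurable_id.pow_const 2)).pow_const 2).aestronglyMeasurable ?_
  have := nullSingletonClass_gaussianReal (μ := 0) (v := 1) one_ne_zero
  filter_upwards [Measure.ae_ne (gaussianReal 0 1) (0 : ℝ)] with x hx
  rw [Real.norm_of_nonneg (sq_nonneg _)]
  exact log_sq_le_rpow (by positivity)

lemma memLp_sq_sub_one_gaussianReal : MemLp (fun x : ℝ => x ^ 2 - 1) 2 (gaussianReal 0 1) := by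
  have h : MemLp (fun x : ℝ => x ^ 2) 2 (gaussianReal 0 1) := by
    rw [memLp_two_iff_integrable_sq (by fun_prop)]
    have := (memLp_id_gaussianReal (μ := 0) (v := 1) 4).integrable_norm_pow (p := 4) (by norm_num)
    refine this.congr (ae_of_all _ fun x => ?_)
    simp only [id, Real.norm_eq_abs, ← pow_mul]
    exact (by decide : Even 4).pow_abs x
  exact h.sub (memLp_const 1)

variable {Ω : Type*} [MeasurableSpace Ω] {P : Measure Ω}

lemma hasLaw_div_sqrt {D : Ω → ℝ} {v : ℝ≥0} (hv : 0 < v) (hD : HasLaw D (gaussianReal 0 v) P) :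
    HasLaw (fun ω => D ω / √v) (gaussianReal 0 1) P := by
  have h := gaussianReal_div_const hD (√v)
  convert h using 2
  · simp
  · ext; simp [hv.ne']

section increments
variable {D : Ω → ℝ} {v : ℝ≥0}

lemma ae_ne_zero_of_gaussian (hv : 0 < v) (hD : HasLaw D (gaussianReal 0 v) P) :
    ∀ᵐ ω ∂P, D ω ≠ 0 := by
  have := nullSingletonClass_gaussianReal (μ := 0) (v := v) hv.ne'
  exact (hD.ae_iff (p := fun x => x ≠ 0) (by fun_prop)).2 (Measure.ae_ne _ _)

lemma hasLaw_sqrt_mul (v : ℝ≥0) :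
    HasLaw (fun x : ℝ => √v * x) (gaussianReal 0 v) (gaussianReal 0 1) := by
  have h := gaussianReal_const_mul (HasLaw.id (μ := gaussianReal 0 1)) (√v)
  convert h using 2
  · simp
  · rw [mul_zero]
  · apply NNReal.eq
    simp

lemma memLp_sq_sub_of_gaussian (hD : HasLaw D (gaussianReal 0 v) P) :
    MemLp (fun ω => D ω ^ 2 - v) 2 P ∧ ∫ ω, (D ω ^ 2 - v) ∂P = 0 ∧
      ∫ ω, (D ω ^ 2 - v) ^ 2 ∂P = v ^ 2 * gaussianSqVar := by
  have hs := hasLaw_sqrt_mul v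
  have e : ∀ x : ℝ, (√v * x) ^ 2 - v = v * (x ^ 2 - 1) := fun x => by
    rw [mul_pow, Real.sq_sqrt (NNReal.coe_nonneg v)]; ring
  have hmem : MemLp (fun x : ℝ => x ^ 2 - v) 2 (gaussianReal 0 v) := by
    rw [← hs.map_eq, memLp_map_measure_iff (by fun_prop) (by fun_prop)]
    simp only [Function.comp_def, e]
    exact memLp_sq_sub_one_gaussianReal.const_mul _
  refine ⟨?_, ?_, ?_⟩
  · rw [← hD.map_eq, memLp_map_measure_iff (by fun_prop) hD.aemeasurable] at hmem
    exact hmem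
  · have h1 := hD.integral_comp (f := fun x : ℝ => x ^ 2 - v) (by fun_prop)
    have h2 := hs.integral_comp (f := fun x : ℝ => x ^ 2 - v) (by fun_prop)
    simp only [Function.comp_def, e] at h1 h2
    have hi : Integrable (fun x : ℝ => x ^ 2) (gaussianReal 0 1) :=
      (memLp_id_gaussianReal 2).integrable_sq
    rw [h1, ← h2, integral_const_mul, integral_sub hi (integrable_const 1)]
    have := variance_id_gaussianReal (μ := 0) (v := 1)
    rw [variance_of_integral_eq_zero aemeasurable_id (by simp)] at this
    simp only [id] at this
    simp [this]
  · have h1 := hD.integral_comp (f := fun x : ℝ => (x ^ 2 - v) ^ 2) (by fun_prop)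
    have h2 := hs.integral_comp (f := fun x : ℝ => (x ^ 2 - v) ^ 2) (by fun_prop)
    simp only [Function.comp_def, e, mul_pow (v : ℝ)] at h1 h2
    rw [h1, ← h2, integral_const_mul, gaussianSqVar]

lemma integrable_log_sq_of_gaussian (hv : 0 < v) (hD : HasLaw D (gaussianReal 0 v) P) :
    Integrable (fun ω => Real.log (D ω ^ 2 / v) ^ 2) P ∧
      ∫ ω, Real.log (D ω ^ 2 / v) ^ 2 ∂P = gaussianLogMoment := by
  have h := hasLaw_div_sqrt hv hD
  have hm : Measurable fun x : ℝ => Real.log (x ^ 2) ^ 2 :=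
    (Real.measurable_log.comp (measurable_id.pow_const 2)).pow_const 2
  have e : ∀ ω, Real.log (D ω ^ 2 / v) ^ 2 = Real.log ((D ω / √v) ^ 2) ^ 2 := fun ω => by
    rw [div_pow, Real.sq_sqrt (NNReal.coe_nonneg v)]
  simp only [e]
  refine ⟨?_, h.integral_comp (f := fun x : ℝ => Real.log (x ^ 2) ^ 2) hm.aestronglyMeasurable⟩
  have := integrable_log_sq_gaussianReal
  rw [← h.map_eq, integrable_map_measure hm.aestronglyMeasurable h.aemeasurable] at this
  exact this

end increments

/-! ### Uniform logarithmic error of a realized variance -/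

/-- The second moment of `log (S / V)`, where `S` is a sum of squared Gaussian increments and `V`
its mean, is bounded by a universal constant, by Jensen's inequality. -/
lemma integral_log_ratio_sq_le {D : ℕ → Ω → ℝ} {v : ℕ → ℝ≥0} {k : ℕ} (hk : 0 < k)
    (hv : ∀ j < k, 0 < v j) (hD : ∀ j < k, HasLaw (D j) (gaussianReal 0 (v j)) P) :
    Integrable (fun ω => Real.log ((∑ j ∈ Finset.range k, D j ω ^ 2) /
        ∑ j ∈ Finset.range k, (v j : ℝ)) ^ 2) P ∧
      ∫ ω, Real.log ((∑ j ∈ Finset.range k, D j ω ^ 2) /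
        ∑ j ∈ Finset.range k, (v j : ℝ)) ^ 2 ∂P ≤ 4 + gaussianLogMoment := by
  set V : ℝ := ∑ j ∈ Finset.range k, (v j : ℝ) with hV
  have hV0 : 0 < V := Finset.sum_pos (fun j hj => hv j (Finset.mem_range.1 hj)) ⟨0, by simpa⟩
  have hsq : ∀ j < k, Integrable (fun ω => D j ω ^ 2) P ∧ ∫ ω, D j ω ^ 2 ∂P = v j := by
    intro j hj
    have := (hD j hj).isProbabilityMeasure
    obtain ⟨h1, h2, -⟩ := memLp_sq_sub_of_gaussian (hD j hj)
    have h3 : Integrable (fun ω => D j ω ^ 2) P := by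
      refine ((h1.integrable one_le_two).add (integrable_const (v j : ℝ))).congr
        (ae_of_all _ fun ω => ?_)
      simp
    refine ⟨h3, ?_⟩
    rw [integral_sub h3 (integrable_const _)] at h2
    simpa [sub_eq_zero] using h2
  -- the dominating variable of Jensen's inequality for the weights `v j / V` and the points
  -- `D j ^ 2 / v j`
  set U : Ω → ℝ := fun ω => 4 * ∑ j ∈ Finset.range k, V⁻¹ * D j ω ^ 2 +
    ∑ j ∈ Finset.range k, (v j / V) * Real.log (D j ω ^ 2 / v j) ^ 2 with hU
  have hi1 : ∀ j ∈ Finset.range k, Integrable (fun ω => V⁻¹ * D j ω ^ 2) P := fun j hj =>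
    (hsq j (Finset.mem_range.1 hj)).1.const_mul _
  have hi2 : ∀ j ∈ Finset.range k,
      Integrable (fun ω => (v j / V) * Real.log (D j ω ^ 2 / v j) ^ 2) P := fun j hj =>
    (integrable_log_sq_of_gaussian (hv j (Finset.mem_range.1 hj))
      (hD j (Finset.mem_range.1 hj))).1.const_mul _
  have hUi : Integrable U P :=
    ((integrable_finsetSum _ hi1).const_mul 4).add (integrable_finsetSum _ hi2)
  have hUe : ∫ ω, U ω ∂P = 4 + gaussianLogMoment := by
    rw [hU, integral_add ((integrable_finsetSum _ hi1).const_mul 4) (integrable_finsetSum _ hi2),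
      integral_const_mul, integral_finsetSum _ hi1, integral_finsetSum _ hi2]
    congr 1
    · rw [Finset.sum_congr rfl fun j hj => by
        rw [integral_const_mul, (hsq j (Finset.mem_range.1 hj)).2], ← Finset.mul_sum, ← hV,
        inv_mul_cancel₀ hV0.ne', mul_one]
    · rw [Finset.sum_congr rfl fun j hj => by
        rw [integral_const_mul, (integrable_log_sq_of_gaussian (hv j (Finset.mem_range.1 hj))
          (hD j (Finset.mem_range.1 hj))).2], ← Finset.sum_mul, ← Finset.sum_div, ← hV,
        div_self hV0.ne', one_mul]
  have hle : ∀ᵐ ω ∂P, Real.log ((∑ j ∈ Finset.range k, D j ω ^ 2) / V) ^ 2 ≤ U ω := by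
    have hne : ∀ᵐ ω ∂P, ∀ j < k, D j ω ≠ 0 := by
      rw [ae_all_iff]; intro j
      by_cases hj : j < k
      · filter_upwards [ae_ne_zero_of_gaussian (hv j hj) (hD j hj)] with ω h _ using h
      · simp [hj]
    filter_upwards [hne] with ω hω
    have h := log_sum_sq_le (Finset.range k) (w := fun j => v j / V)
      (z := fun j => D j ω ^ 2 / v j) (fun j _ => by positivity)
      (by rw [← Finset.sum_div, ← hV, div_self hV0.ne']) fun j hj => by
        have := hv j (Finset.mem_range.1 hj)
        have := hω j (Finset.mem_range.1 hj)
        positivity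
    have e : ∀ j ∈ Finset.range k, (v j / V) * (D j ω ^ 2 / v j) = V⁻¹ * D j ω ^ 2 := by
      intro j hj
      have : (v j : ℝ) ≠ 0 := by exact_mod_cast (hv j (Finset.mem_range.1 hj)).ne'
      field_simp
    rw [Finset.sum_congr rfl e] at h
    rw [div_eq_inv_mul, Finset.mul_sum]
    exact h
  have hm : AEStronglyMeasurable (fun ω => Real.log ((∑ j ∈ Finset.range k, D j ω ^ 2) / V) ^ 2)
      P := by
    have : AEMeasurable (fun ω => (∑ j ∈ Finset.range k, D j ω ^ 2) / V) P :=
      (Finset.aemeasurable_fun_sum _ fun j hj =>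
        (hD j (Finset.mem_range.1 hj)).aemeasurable.pow_const 2).div_const V
    exact ((Real.measurable_log.comp_aemeasurable this).pow_const 2).aestronglyMeasurable
  have hint := hUi.mono' hm (hle.mono fun ω h => by
    rwa [Real.norm_of_nonneg (sq_nonneg _)])
  exact ⟨hint, (integral_mono_ae hint hUi hle).trans hUe.le⟩

/-- Deterministic error bound for two nondecreasing sequences `S` and `V` that are within `Z` of
each other. Where `S k₀ ≥ c / 2` the logarithm is Lipschitz; otherwise `Z ≥ c / 2`, and the
logarithms of `S` are trapped between those of `S k₀` and `S m`. The free parameter `s` enters through Young's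
inequality. -/
lemma abs_log_sub_log_le_of_monotone {c B s Z : ℝ} {S V : ℕ → ℝ} {k₀ k m : ℕ} (hc : 0 < c)
    (hs0 : 0 < s) (hSm : Monotone S) (hVm : Monotone V) (hk₀ : 0 < k₀)
    (hSpos : ∀ k, 0 < k → 0 < S k)
    (hcV : c ≤ V k₀) (hVB : V m ≤ B) (hMk : ∀ k ≤ m, |S k - V k| ≤ Z) (hk : k₀ ≤ k) (hk' : k ≤ m) :
    |Real.log (S k) - Real.log (V k)| ≤ s / c +
      3 / 2 * s * (Real.log (S k₀ / V k₀) ^ 2 + Real.log (S m / V m) ^ 2 + Real.log (B / c) ^ 2) +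
      (1 / c + 2 / c ^ 2) / s * Z ^ 2 := by
  have hkm := hk.trans hk'
  have hVk : ∀ k, k₀ ≤ k → c ≤ V k := fun k hk => hcV.trans (hVm hk)
  have hV0 : ∀ k, k₀ ≤ k → 0 < V k := fun k hk => hc.trans_le (hVk k hk)
  have hZ0 : 0 ≤ Z := (abs_nonneg _).trans (hMk 0 (by omega))
  have e1 : Real.log (S k₀ / V k₀) = Real.log (S k₀) - Real.log (V k₀) :=
    Real.log_div (hSpos _ hk₀).ne' (hV0 _ le_rfl).ne'
  have e2 : Real.log (S m / V m) = Real.log (S m) - Real.log (V m) :=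
    Real.log_div (hSpos _ (by omega)).ne' (hV0 _ hkm).ne'
  have hBc : c ≤ B := (hVk m hkm).trans hVB
  have e3 : Real.log (V m) - Real.log (V k₀) ≤ Real.log (B / c) := by
    rw [Real.log_div (hc.trans_le hBc).ne' hc.ne']
    linarith [Real.log_le_log (hV0 m hkm) hVB, Real.log_le_log hc hcV]
  generalize Real.log (S k₀ / V k₀) = L₁ at *
  generalize Real.log (S m / V m) = L₂ at *
  generalize Real.log (B / c) = ℓ at *
  have hnn : 0 ≤ 3 / 2 * s * (L₁ ^ 2 + L₂ ^ 2 + ℓ ^ 2) := by positivity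
  have hnn' : 0 ≤ 1 / c / s * Z ^ 2 := by positivity
  have hnn'' : 0 ≤ 2 / c ^ 2 / s * Z ^ 2 := by positivity
  have hsc : 0 ≤ s / c := by positivity
  have esplit : (1 / c + 2 / c ^ 2) / s * Z ^ 2 = 1 / c / s * Z ^ 2 + 2 / c ^ 2 / s * Z ^ 2 := by
    ring
  rw [esplit]
  rcases le_or_gt (c / 2) (S k₀) with hcase | hcase
  · have h1 := abs_log_sub_log_le (half_pos hc) (hcase.trans (hSm hk))
      ((half_le_self hc.le).trans (hVk k hk))
    have h3 : 2 * Z ≤ s + Z ^ 2 / s := by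
      have : 0 ≤ (s - Z) ^ 2 / s := by positivity
      have e : (s - Z) ^ 2 / s = s - 2 * Z + Z ^ 2 / s := by field_simp; ring
      linarith
    have h2 : |S k - V k| / (c / 2) ≤ s / c + 1 / c / s * Z ^ 2 := by
      calc _ ≤ Z / (c / 2) := by gcongr; exact hMk k hk'
        _ = (2 * Z) / c := by field_simp
        _ ≤ (s + Z ^ 2 / s) / c := by gcongr
        _ = _ := by field_simp
    linarith
  · have hlog : |Real.log (S k) - Real.log (V k)| ≤ |L₁| + |L₂| + ℓ := by
      have a1 := Real.log_le_log (hSpos k₀ hk₀) (hSm hk)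
      have a2 := Real.log_le_log (hSpos k (by omega)) (hSm hk')
      have a3 := Real.log_le_log (hV0 k₀ le_rfl) (hVm hk)
      have a4 := Real.log_le_log (hV0 k hk) (hVm hk')
      have b1 := neg_abs_le L₁
      have b2 := le_abs_self L₂
      have b3 := abs_nonneg L₁
      have b4 := abs_nonneg L₂
      rw [abs_le]
      constructor <;> linarith
    have hZc : c / 2 ≤ Z := by
      have := hMk k₀ hkm
      rw [abs_le] at this
      linarith [hVk k₀ le_rfl]
    have h1 : 1 ≤ 4 / c ^ 2 * Z ^ 2 := by
      rw [div_mul_eq_mul_div, le_div_iff₀ (by positivity)]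
      nlinarith
    have hY2 : (|L₁| + |L₂| + ℓ) ^ 2 ≤ 3 * (L₁ ^ 2 + L₂ ^ 2 + ℓ ^ 2) := by
      rw [← sq_abs L₁, ← sq_abs L₂]
      nlinarith [sq_nonneg (|L₁| - |L₂|), sq_nonneg (|L₁| - ℓ), sq_nonneg (|L₂| - ℓ)]
    generalize |L₁| + |L₂| + ℓ = Y at *
    have h2 : Y ≤ s * Y ^ 2 / 2 + 1 / (2 * s) := by
      have : 0 ≤ (s * Y - 1) ^ 2 / (2 * s) := by positivity
      have e : (s * Y - 1) ^ 2 / (2 * s) = s * Y ^ 2 / 2 - Y + 1 / (2 * s) := by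
        field_simp
        ring
      linarith
    have h3 : 1 / (2 * s) ≤ 2 / c ^ 2 / s * Z ^ 2 := by
      calc 1 / (2 * s) ≤ (4 / c ^ 2 * Z ^ 2) / (2 * s) := by gcongr
        _ = _ := by field_simp; ring
    have h4 : s * Y ^ 2 / 2 ≤ 3 / 2 * s * (L₁ ^ 2 + L₂ ^ 2 + ℓ ^ 2) := by
      have := mul_le_mul_of_nonneg_left hY2 hs0.le
      linarith
    linarith

/-- Sums of squares of independent centred Gaussian increments: if all variances are at most `b`,
the error of `log S` against `log V`, uniformly over times at which `V ≥ c`, is of order `√b` in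
`L¹`. On the event `S k₀ < c / 2`, of probability `O(b)`, monotonicity of `S` and the logarithmic
moments at the two end points replace the Lipschitz bound. -/
theorem exists_log_error_bound {c B : ℝ} (hc : 0 < c) :
    ∃ C : ℝ, ∀ (Q : Measure Ω) [IsProbabilityMeasure Q] (D : ℕ → Ω → ℝ) (v : ℕ → ℝ≥0) (b : ℝ)
      (k₀ m : ℕ), 0 < b → 0 < k₀ → k₀ ≤ m → (∀ j < m, 0 < v j) → (∀ j < m, (v j : ℝ) ≤ b) →
      (∀ j, HasLaw (D j) (gaussianReal 0 (v j)) Q) → iIndepFun D Q →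
      c ≤ ∑ j ∈ Finset.range k₀, (v j : ℝ) → ∑ j ∈ Finset.range m, (v j : ℝ) ≤ B →
      ∃ Z : Ω → ℝ, Integrable Z Q ∧ ∫ ω, Z ω ∂Q ≤ C * √b ∧
        ∀ᵐ ω ∂Q, ∀ k, k₀ ≤ k → k ≤ m →
          |Real.log (∑ j ∈ Finset.range k, D j ω ^ 2) -
            Real.log (∑ j ∈ Finset.range k, (v j : ℝ))| ≤ Z ω := by
  set ℓ := Real.log (B / c) with hℓ
  refine ⟨1 / c + 3 / 2 * (2 * (4 + gaussianLogMoment) + ℓ ^ 2) +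
    (1 / c + 2 / c ^ 2) * (8 * (B * gaussianSqVar)), ?_⟩
  intro Q _ D v b k₀ m hb hk₀ hkm hv hvb hD hind hcV hVB
  set s := √b with hs
  have hs0 : 0 < s := Real.sqrt_pos.2 hb
  have hsb : s ^ 2 = b := Real.sq_sqrt hb.le
  set V : ℕ → ℝ := fun k => ∑ j ∈ Finset.range k, (v j : ℝ) with hV
  set S : ℕ → Ω → ℝ := fun k ω => ∑ j ∈ Finset.range k, D j ω ^ 2 with hS
  have hVm : Monotone V := monotone_nat_of_le_succ fun n => by
    simp only [hV, Finset.sum_range_succ]; linarith [(v n).2]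
  have hSm : ∀ ω, Monotone fun k => S k ω := fun ω => monotone_nat_of_le_succ fun n => by
    simp only [hS, Finset.sum_range_succ]; linarith [sq_nonneg (D n ω)]
  obtain ⟨Z₀, hZ, hZle, hZint⟩ := exists_maximal_bound (P := Q) (X := fun j ω => D j ω ^ 2 - v j)
    (fun j => (memLp_sq_sub_of_gaussian (hD j)).1)
    (hind.comp (fun j x => x ^ 2 - v j) fun j => by fun_prop)
    (fun j => (memLp_sq_sub_of_gaussian (hD j)).2.1) m
  have hZint' : ∫ ω, Z₀ ω ^ 2 ∂Q ≤ 8 * (B * gaussianSqVar) * b := by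
    refine hZint.trans ?_
    simp only [(memLp_sq_sub_of_gaussian (hD _)).2.2]
    rw [← Finset.sum_mul]
    have : ∑ j ∈ Finset.range m, (v j : ℝ) ^ 2 ≤ b * B := by
      calc _ ≤ ∑ j ∈ Finset.range m, b * (v j : ℝ) := Finset.sum_le_sum fun j hj => by
            rw [sq]; exact mul_le_mul_of_nonneg_right (hvb j (Finset.mem_range.1 hj)) (v j).2
        _ ≤ b * B := by rw [← Finset.mul_sum]; gcongr
    nlinarith [mul_le_mul_of_nonneg_right this gaussianSqVar_nonneg]
  obtain ⟨hL1, hL1'⟩ := integral_log_ratio_sq_le (P := Q) (D := D) (v := v) hk₀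
    (fun j hj => hv j (by omega)) fun j _ => hD j
  obtain ⟨hL2, hL2'⟩ := integral_log_ratio_sq_le (P := Q) (D := D) (v := v)
    (by omega : 0 < m) hv fun j _ => hD j
  set L₁ : Ω → ℝ := fun ω => Real.log (S k₀ ω / V k₀) with hL₁
  set L₂ : Ω → ℝ := fun ω => Real.log (S m ω / V m) with hL₂
  replace hL1 : Integrable (fun ω => L₁ ω ^ 2) Q := hL1
  replace hL2 : Integrable (fun ω => L₂ ω ^ 2) Q := hL2
  have hi1 : Integrable (fun ω => 3 / 2 * s * (L₁ ω ^ 2 + L₂ ω ^ 2 + ℓ ^ 2)) Q :=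
    ((hL1.add hL2).add (integrable_const _)).const_mul _
  have hi2 : Integrable (fun ω => (1 / c + 2 / c ^ 2) / s * Z₀ ω ^ 2) Q :=
    hZ.integrable_sq.const_mul _
  refine ⟨fun ω => s / c + 3 / 2 * s * (L₁ ω ^ 2 + L₂ ω ^ 2 + ℓ ^ 2) +
    (1 / c + 2 / c ^ 2) / s * Z₀ ω ^ 2, ((integrable_const _).add hi1).add hi2, ?_, ?_⟩
  · have e : ∫ ω, (s / c + 3 / 2 * s * (L₁ ω ^ 2 + L₂ ω ^ 2 + ℓ ^ 2) +
        (1 / c + 2 / c ^ 2) / s * Z₀ ω ^ 2) ∂Q = s / c + 3 / 2 * s *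
        (∫ ω, L₁ ω ^ 2 ∂Q + ∫ ω, L₂ ω ^ 2 ∂Q + ℓ ^ 2) +
        (1 / c + 2 / c ^ 2) / s * ∫ ω, Z₀ ω ^ 2 ∂Q := by
      have hi0 : Integrable (fun ω => s / c + 3 / 2 * s * (L₁ ω ^ 2 + L₂ ω ^ 2 + ℓ ^ 2)) Q :=
        (integrable_const _).add hi1
      have hi3 : Integrable (fun ω => L₁ ω ^ 2 + L₂ ω ^ 2) Q := hL1.add hL2
      rw [integral_add hi0 hi2, integral_add (integrable_const _) hi1,
        integral_const_mul, integral_const_mul, integral_add hi3 (integrable_const _),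
        integral_add hL1 hL2]
      simp
    rw [e]
    have h1 : (1 / c + 2 / c ^ 2) / s * ∫ ω, Z₀ ω ^ 2 ∂Q ≤
        (1 / c + 2 / c ^ 2) * (8 * (B * gaussianSqVar)) * s := by
      calc _ ≤ (1 / c + 2 / c ^ 2) / s * (8 * (B * gaussianSqVar) * b) := by gcongr
        _ = _ := by rw [← hsb]; field_simp
    have h2 : 3 / 2 * s * (∫ ω, L₁ ω ^ 2 ∂Q + ∫ ω, L₂ ω ^ 2 ∂Q + ℓ ^ 2) ≤
        3 / 2 * s * (2 * (4 + gaussianLogMoment) + ℓ ^ 2) := by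
      gcongr; linarith
    calc _ ≤ s / c + 3 / 2 * s * (2 * (4 + gaussianLogMoment) + ℓ ^ 2) +
          (1 / c + 2 / c ^ 2) * (8 * (B * gaussianSqVar)) * s := by gcongr
      _ = _ := by ring
  · have hne : ∀ᵐ ω ∂Q, D 0 ω ≠ 0 := ae_ne_zero_of_gaussian (hv 0 (by omega)) (hD 0)
    filter_upwards [hne] with ω hω k hk hk'
    have hMk : ∀ k ≤ m, |S k ω - V k| ≤ Z₀ ω := fun k hk => by
      simpa [hS, hV, Finset.sum_sub_distrib] using hZle ω k hk
    have hSpos : ∀ k, 0 < k → 0 < S k ω := fun k hk =>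
      Finset.sum_pos' (fun j _ => sq_nonneg _) ⟨0, by simpa, by positivity⟩
    exact abs_log_sub_log_le_of_monotone hc hs0 (hSm ω) hVm hk₀ hSpos hcV hVB hMk hk hk'

end LogMoments

section Autoregression

/-! ### Stationary autoregressions -/

variable {Ω : Type*}

/-- The sequence `y` is bounded in probability: `P (|y_i| > K)` is small, uniformly in `i`, for
large `K`. -/
def IsTight [MeasurableSpace Ω] (P : Measure Ω) (y : ℤ → Ω → ℂ) : Prop :=
  ∀ δ : ℝ≥0∞, 0 < δ → ∃ K : ℝ≥0, ∀ i, P {ω | (K : ℝ≥0∞) < ‖y i ω‖ₑ} ≤ δ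

/-- The backshift operator `(L y)_i = y_{i-1}` on complex sequences of random variables. -/
def backshift (Ω : Type*) : Module.End ℂ (ℤ → Ω → ℂ) where
  toFun y i := y (i - 1)
  map_add' _ _ := rfl
  map_smul' _ _ := rfl

lemma backshift_apply (y : ℤ → Ω → ℂ) (i : ℤ) : backshift Ω y i = y (i - 1) := rfl

lemma backshift_pow_apply (y : ℤ → Ω → ℂ) (n : ℕ) (i : ℤ) :
    (backshift Ω ^ n) y i = y (i - n) := by
  induction n generalizing i with
  | zero => simp
  | succ n ih =>
    rw [pow_succ', Module.End.mul_apply, backshift_apply, ih]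
    congr 1
    push_cast
    ring

/-- The autoregressive polynomial `1 - φ₁ X - ⋯ - φ_p X^p` over `ℂ`. -/
noncomputable def arPoly {p : ℕ} (φ : Fin p → ℝ) : Polynomial ℂ :=
  1 - ∑ j : Fin p, Polynomial.C (φ j : ℂ) * Polynomial.X ^ ((j : ℕ) + 1)

lemma eval_arPoly {p : ℕ} (φ : Fin p → ℝ) (z : ℂ) :
    (arPoly φ).eval z = 1 - ∑ j : Fin p, (φ j : ℂ) * z ^ ((j : ℕ) + 1) := by
  simp [arPoly, Polynomial.eval_finsetSum]

lemma aeval_arPoly {p : ℕ} (φ : Fin p → ℝ) (y : ℤ → Ω → ℂ) (i : ℤ) (ω : Ω) :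
    Polynomial.aeval (backshift Ω) (arPoly φ) y i ω =
      y i ω - ∑ j : Fin p, (φ j : ℂ) * y (i - ((j : ℕ) + 1 : ℤ)) ω := by
  simp only [arPoly, map_sub, map_one, map_sum, map_mul, map_pow, Polynomial.aeval_X,
    Polynomial.aeval_C, LinearMap.sub_apply, Pi.sub_apply, Module.End.one_apply,
    LinearMap.sum_apply, Finset.sum_apply, Module.End.mul_apply, Module.algebraMap_end_apply,
    Pi.smul_apply, smul_eq_mul, backshift_pow_apply]
  push_cast
  rfl

variable [MeasurableSpace Ω] {P : Measure Ω}

lemma IsTight.add {y z : ℤ → Ω → ℂ} (hy : IsTight P y) (hz : IsTight P z) : IsTight P (y + z) := by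
  intro δ hδ
  obtain ⟨K, hK⟩ := hy (δ / 2) (ENNReal.half_pos hδ.ne')
  obtain ⟨K', hK'⟩ := hz (δ / 2) (ENNReal.half_pos hδ.ne')
  refine ⟨K + K', fun i => ?_⟩
  calc P {ω | ((K + K' : ℝ≥0) : ℝ≥0∞) < ‖(y + z) i ω‖ₑ}
      ≤ P ({ω | (K : ℝ≥0∞) < ‖y i ω‖ₑ} ∪ {ω | (K' : ℝ≥0∞) < ‖z i ω‖ₑ}) := by
        refine measure_mono fun ω hω => ?_
        by_contra hcon
        simp only [mem_union, mem_ofPred_eq, not_or, not_lt] at hcon hω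
        refine absurd hω (not_lt.2 ?_)
        push_cast
        exact (enorm_add_le (y i ω) (z i ω)).trans (add_le_add hcon.1 hcon.2)
    _ ≤ δ / 2 + δ / 2 := (measure_union_le _ _).trans (add_le_add (hK i) (hK' i))
    _ = δ := ENNReal.add_halves δ

lemma IsTight.smul {y : ℤ → Ω → ℂ} (hy : IsTight P y) (c : ℂ) : IsTight P (c • y) := by
  intro δ hδ
  obtain ⟨K, hK⟩ := hy δ hδ
  refine ⟨‖c‖₊ * K, fun i => (measure_mono fun ω hω => ?_).trans (hK i)⟩
  simp only [mem_ofPred_eq] at hω ⊢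
  by_contra hcon
  refine absurd hω (not_lt.2 ?_)
  simp only [Pi.smul_apply, smul_eq_mul, enorm_mul, ENNReal.coe_mul]
  exact mul_le_mul_right (not_lt.1 hcon) _

lemma IsTight.backshift {y : ℤ → Ω → ℂ} (hy : IsTight P y) :
    IsTight P (FunctionalSV.backshift Ω y) := fun δ hδ =>
  let ⟨K, hK⟩ := hy δ hδ; ⟨K, fun i => hK (i - 1)⟩

/-- If `(L - r) y = e` with `|r| > 1`, `y` bounded in probability and `e` bounded in `L¹`, then `y`
is bounded in `L¹`: unrolling `y_i = r⁻¹ (y_{i-1} - e_i)` gives `|y_i| ≤ ∑_k |r|^{-k-1} |e_{i-k}|`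
almost surely, as the remainder `|r|^{-n} |y_{i-n}|` vanishes in probability. -/
lemma exists_lintegral_le_of_root {y : ℤ → Ω → ℂ} (hy : IsTight P y) {r : ℂ} (hr : 1 < ‖r‖)
    {C : ℝ≥0} (hm : ∀ i, AEMeasurable (y i) P)
    (he : ∀ i, ∫⁻ ω, ‖(backshift Ω y - r • y) i ω‖ₑ ∂P ≤ C) :
    ∃ C' : ℝ≥0, ∀ i, ∫⁻ ω, ‖y i ω‖ₑ ∂P ≤ C' := by
  set e : ℤ → Ω → ℂ := backshift Ω y - r • y with he_def
  set q : ℝ≥0∞ := ‖r‖ₑ⁻¹ with hq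
  have hr0 : r ≠ 0 := by rintro rfl; simp at hr; linarith
  have hq1 : q < 1 := by
    rw [hq, ENNReal.inv_lt_one, enorm_eq_nnnorm]
    exact_mod_cast hr
  have hstep : ∀ i ω, ‖y i ω‖ₑ ≤ q * ‖e i ω‖ₑ + q * ‖y (i - 1) ω‖ₑ := by
    intro i ω
    have h1 : y i ω = r⁻¹ * (y (i - 1) ω - e i ω) := by
      simp only [he_def, Pi.sub_apply, backshift_apply, Pi.smul_apply, smul_eq_mul]
      field_simp
      ring
    rw [h1, enorm_mul, enorm_inv hr0, ← mul_add, add_comm]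
    exact mul_le_mul_right (enorm_sub_le) _
  have hunroll : ∀ n i ω, ‖y i ω‖ₑ ≤
      ∑ k ∈ Finset.range n, q ^ (k + 1) * ‖e (i - k) ω‖ₑ + q ^ n * ‖y (i - n) ω‖ₑ := by
    intro n i ω
    induction n with
    | zero => simp
    | succ n ih =>
      refine ih.trans ?_
      rw [Finset.sum_range_succ, add_assoc]
      gcongr
      calc q ^ n * ‖y (i - n) ω‖ₑ
          ≤ q ^ n * (q * ‖e (i - n) ω‖ₑ + q * ‖y (i - n - 1) ω‖ₑ) := by
            gcongr; exact hstep _ _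
        _ = _ := by
            rw [mul_add, ← mul_assoc, ← mul_assoc, ← pow_succ]
            push_cast
            rw [sub_sub]
  set Z : ℤ → Ω → ℝ≥0∞ := fun i ω => ∑' k : ℕ, q ^ (k + 1) * ‖e (i - k) ω‖ₑ with hZ
  have hle : ∀ i, ∀ᵐ ω ∂P, ‖y i ω‖ₑ ≤ Z i ω := by
    intro i
    -- it suffices to exclude each gap `1 / (j + 1)`
    have hgap : ∀ j : ℕ, P {ω | Z i ω + ((j : ℝ≥0∞) + 1)⁻¹ < ‖y i ω‖ₑ} = 0 := by
      intro j
      refine le_antisymm (ENNReal.le_of_forall_pos_le_add fun δ hδ _ => ?_) zero_le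
      rw [zero_add]
      obtain ⟨K, hK⟩ := hy δ (by exact_mod_cast hδ)
      have ht : Tendsto (fun n : ℕ => q ^ n * K) atTop (𝓝 0) := by
        simpa using ENNReal.Tendsto.mul_const (ENNReal.tendsto_pow_atTop_nhds_zero_of_lt_one hq1)
          (Or.inr (ENNReal.coe_ne_top (r := K)))
      have hpos : (0 : ℝ≥0∞) < ((j : ℝ≥0∞) + 1)⁻¹ := ENNReal.inv_pos.2 (by finiteness)
      obtain ⟨n, hn⟩ := (ht.eventually (gt_mem_nhds hpos)).exists
      refine (measure_mono fun ω hω => ?_).trans (hK (i - n))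
      simp only [mem_ofPred_eq] at hω ⊢
      by_contra hcon
      refine absurd hω (not_lt.2 ((hunroll n i ω).trans ?_))
      gcongr
      · exact ENNReal.sum_le_tsum _
      · exact (mul_le_mul_right (not_lt.1 hcon) _).trans hn.le
    have hall : ∀ᵐ ω ∂P, ∀ j : ℕ, ‖y i ω‖ₑ ≤ Z i ω + ((j : ℝ≥0∞) + 1)⁻¹ := by
      rw [ae_all_iff]
      intro j
      rw [ae_iff]
      simpa only [not_le] using hgap j
    filter_upwards [hall] with ω hω
    have ht : Tendsto (fun j : ℕ => Z i ω + ((j : ℝ≥0∞) + 1)⁻¹) atTop (𝓝 (Z i ω + 0)) := by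
      refine tendsto_const_nhds.add ?_
      have := (tendsto_add_atTop_iff_nat 1).2 ENNReal.tendsto_inv_nat_nhds_zero
      simpa using this
    rw [add_zero] at ht
    exact ge_of_tendsto' ht hω
  have hsum : ∑' k : ℕ, q ^ (k + 1) * C ≠ ∞ := by
    rw [ENNReal.tsum_mul_right, ENNReal.tsum_geometric_add_one]
    have : 1 - q ≠ 0 := (tsub_pos_of_lt hq1).ne'
    have : q ≠ ∞ := (hq1.trans ENNReal.one_lt_top).ne
    finiteness
  refine ⟨(∑' k : ℕ, q ^ (k + 1) * C).toNNReal, fun i => ?_⟩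
  rw [ENNReal.coe_toNNReal hsum]
  have hem : ∀ i, AEMeasurable (e i) P := fun i => (hm (i - 1)).sub ((hm i).const_smul r)
  calc ∫⁻ ω, ‖y i ω‖ₑ ∂P ≤ ∫⁻ ω, Z i ω ∂P := lintegral_mono_ae (hle i)
    _ = ∑' k : ℕ, ∫⁻ ω, q ^ (k + 1) * ‖e (i - k) ω‖ₑ ∂P :=
        lintegral_tsum fun k => (hem _).enorm.const_mul _
    _ ≤ ∑' k : ℕ, q ^ (k + 1) * C := by
        refine ENNReal.tsum_le_tsum fun k => ?_
        rw [lintegral_const_mul'' _ (hem _).enorm]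
        gcongr
        exact he _

/-- If `p(L) y` is bounded in `L¹`, where all roots of `p` lie outside the closed unit disk, and `y`
is bounded in probability, then `y` is bounded in `L¹`: remove the factors `L - r` one at a time. -/
lemma exists_lintegral_le_of_prod (s : Multiset ℂ) (hs : ∀ r ∈ s, 1 < ‖r‖) {y : ℤ → Ω → ℂ}
    (hy : IsTight P y) (hm : ∀ i, AEMeasurable (y i) P) {C : ℝ≥0}
    (he : ∀ i, ∫⁻ ω, ‖Polynomial.aeval (backshift Ω)
      (s.map fun r => Polynomial.X - Polynomial.C r).prod y i ω‖ₑ ∂P ≤ C) :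
    ∃ C' : ℝ≥0, ∀ i, ∫⁻ ω, ‖y i ω‖ₑ ∂P ≤ C' := by
  induction s using Multiset.induction_on generalizing y C with
  | empty => exact ⟨C, by simpa using he⟩
  | cons r s ih =>
    have hL : backshift Ω y - r • y =
        Polynomial.aeval (backshift Ω) (Polynomial.X - Polynomial.C r) y := by
      simp [Algebra.algebraMap_eq_smul_one]
    have h1 : IsTight P (backshift Ω y - r • y) := by
      have := hy.backshift.add (hy.smul (-r))
      rwa [neg_smul, ← sub_eq_add_neg] at this
    obtain ⟨C', hC'⟩ := ih (fun r' hr' => hs r' (Multiset.mem_cons_of_mem hr')) h1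
      (fun i => (hm (i - 1)).sub ((hm i).const_smul r)) (C := C) fun i => by
        rw [hL, ← Module.End.mul_apply, ← map_mul, mul_comm]
        simpa only [Multiset.map_cons, Multiset.prod_cons] using he i
    exact exists_lintegral_le_of_root hy (hs r (Multiset.mem_cons_self r s)) hm hC'

variable [IsProbabilityMeasure P]

/-- A strictly stationary sequence is bounded in probability. -/
lemma IsStrictlyStationary.isTight {x : ℤ → Ω → ℝ} (hx : IsStrictlyStationary x P)
    (hm : ∀ i, Measurable (x i)) : IsTight P fun i ω => (x i ω : ℂ) := by
  intro δ hδ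
  have hlaw : ∀ i (K : ℝ≥0), P {ω | (K : ℝ≥0∞) < ‖(x i ω : ℂ)‖ₑ} =
      P {ω | (K : ℝ≥0∞) < ‖x 0 ω‖ₑ} := by
    intro i K
    have h1 := (hx i).comp (measurable_pi_apply (0 : ℤ))
    have h2 := h1.measure_mem_eq (s := {u : ℝ | (K : ℝ≥0∞) < ‖u‖ₑ})
      (measurableSet_lt measurable_const measurable_enorm)
    simpa [Function.comp_def, preimage, enorm_eq_nnnorm] using h2
  have ht : Tendsto (fun n : ℕ => P {ω | ((n : ℝ≥0) : ℝ≥0∞) < ‖x 0 ω‖ₑ}) atTop (𝓝 0) := by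
    have h := tendsto_measure_iInter_atTop (μ := P)
      (s := fun n : ℕ => {ω | ((n : ℝ≥0) : ℝ≥0∞) < ‖x 0 ω‖ₑ})
      (fun n => (measurableSet_lt measurable_const (hm 0).enorm).nullMeasurableSet)
      (fun a b hab ω (hω : ((b : ℝ≥0) : ℝ≥0∞) < ‖x 0 ω‖ₑ) =>
        lt_of_le_of_lt (b := ((b : ℝ≥0) : ℝ≥0∞)) (by simpa using hab) hω) ⟨0, measure_ne_top _ _⟩
    have hemp : ⋂ n : ℕ, {ω | ((n : ℝ≥0) : ℝ≥0∞) < ‖x 0 ω‖ₑ} = ∅ := by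
      refine eq_empty_of_forall_notMem fun ω hω => ?_
      obtain ⟨n, hn⟩ := exists_nat_gt ‖x 0 ω‖₊
      have := mem_iInter.1 hω n
      simp only [mem_ofPred_eq, enorm_eq_nnnorm, ENNReal.coe_lt_coe] at this
      exact absurd this hn.le.not_gt
    rwa [hemp, measure_empty] at h
  obtain ⟨n, hn⟩ := (ht.eventually (gt_mem_nhds hδ)).exists
  exact ⟨n, fun i => (hlaw i n).trans_le hn.le⟩

/-- A strictly stationary solution of a causal autoregression with integrable noise is bounded in
`L¹`. -/
lemma exists_lintegral_le_of_solvesAR {p : ℕ} {φ : Fin p → ℝ} (hφ : IsCausalPolynomial φ)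
    {x ε : ℤ → Ω → ℝ} (hm : ∀ i, Measurable (x i)) (hst : IsStrictlyStationary x P)
    (hAR : SolvesAR φ x ε P) (hε : IsIIDWhiteNoise ε P) :
    ∃ C : ℝ≥0, ∀ i, ∫⁻ ω, ‖x i ω‖ₑ ∂P ≤ C := by
  have hroot : ∀ r ∈ (arPoly φ).roots, 1 < ‖r‖ := by
    intro r hr
    by_contra hcon
    have := Polynomial.isRoot_of_mem_roots hr
    rw [Polynomial.IsRoot, eval_arPoly] at this
    exact hφ r (not_lt.1 hcon) this
  have hlc : (arPoly φ).leadingCoeff ≠ 0 := by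
    rw [Ne, Polynomial.leadingCoeff_eq_zero]
    intro h
    have := eval_arPoly φ 0
    simp [h] at this
  set a := (arPoly φ).leadingCoeff with ha
  have hprod := (IsAlgClosed.splits (arPoly φ)).eq_prod_roots
  obtain ⟨C, hC⟩ : ∃ C : ℝ≥0, ∀ i, ∫⁻ ω, ‖ε i ω‖ₑ ∂P ≤ C := by
    have hfin : ∫⁻ ω, ‖ε 0 ω‖ₑ ∂P ≠ ∞ := ((hε.memLp 0).integrable one_le_two).2.ne
    refine ⟨(∫⁻ ω, ‖ε 0 ω‖ₑ ∂P).toNNReal, fun i => ?_⟩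
    rw [ENNReal.coe_toNNReal hfin]
    exact ((hε.identDistrib i).comp measurable_enorm).lintegral_eq.le
  have hAR' : ∀ i, ∀ᵐ ω ∂P, Polynomial.aeval (backshift Ω) (arPoly φ)
      (fun i ω => (x i ω : ℂ)) i ω = (ε i ω : ℂ) := by
    intro i
    filter_upwards [hAR i] with ω hω
    rw [aeval_arPoly, hω]
    push_cast
    ring
  obtain ⟨C', hC'⟩ := exists_lintegral_le_of_prod (P := P) (arPoly φ).roots hroot
    (hst.isTight hm) (fun i => (Complex.measurable_ofReal.comp (hm i)).aemeasurable)
    (C := ‖a⁻¹‖₊ * C) fun i => by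
      have e : ∀ᵐ ω ∂P, ‖Polynomial.aeval (backshift Ω) ((arPoly φ).roots.map fun r =>
          Polynomial.X - Polynomial.C r).prod (fun i ω => (x i ω : ℂ)) i ω‖ₑ =
          ‖a⁻¹‖ₑ * ‖ε i ω‖ₑ := by
        filter_upwards [hAR' i] with ω hω
        rw [hprod, map_mul, Polynomial.aeval_C, Module.End.mul_apply,
          Module.algebraMap_end_apply, Pi.smul_apply, Pi.smul_apply, smul_eq_mul] at hω
        rw [show ‖ε i ω‖ₑ = ‖(ε i ω : ℂ)‖ₑ by simp [enorm_eq_nnnorm], ← hω, ← enorm_mul,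
          inv_mul_cancel_left₀ hlc]
      rw [lintegral_congr_ae e, lintegral_const_mul'' _
        (hε.memLp i).aestronglyMeasurable.aemeasurable.enorm]
      push_cast
      rw [enorm_eq_nnnorm]
      gcongr
      exact hC i
  refine ⟨C', fun i => ?_⟩
  simpa [enorm_eq_nnnorm] using hC' i

/-- Partial sums of white noise are of order `√N` in `L¹`. -/
lemma exists_integral_abs_sum_noise_le {ε : ℤ → Ω → ℝ} (hε : IsIIDWhiteNoise ε P) :
    ∃ C : ℝ, ∀ N : ℕ, ∫ ω, |∑ i ∈ Finset.Icc 1 N, ε (i : ℤ) ω| ∂P ≤ C * √N := by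
  set V := ∫ ω, ε 0 ω ^ 2 ∂P with hV
  have hVi : ∀ i, ∫ ω, ε i ω ^ 2 ∂P = V := fun i =>
    ((hε.identDistrib i).comp (measurable_id.pow_const 2)).integral_eq
  refine ⟨(1 + V) / 2, fun N => ?_⟩
  rcases Nat.eq_zero_or_pos N with rfl | hN
  · simp
  have hN0 : 0 < √(N : ℝ) := Real.sqrt_pos.2 (by exact_mod_cast hN)
  have hNN : √(N : ℝ) ^ 2 = N := Real.sq_sqrt (Nat.cast_nonneg N)
  have hS : MemLp (fun ω => ∑ i ∈ Finset.Icc 1 N, ε (i : ℤ) ω) 2 P :=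
    memLp_finsetSum _ fun i _ => hε.memLp _
  have h2 := integral_sum_sq_of_iIndepFun (X := fun i : ℕ => ε (i : ℤ)) (fun i => hε.memLp _)
    (hε.indep.precomp Nat.cast_injective) (fun i => hε.mean_zero _) (Finset.Icc 1 N)
  simp only [hVi, Finset.sum_const, Nat.card_Icc, Nat.add_sub_cancel, nsmul_eq_mul] at h2
  calc ∫ ω, |∑ i ∈ Finset.Icc 1 N, ε (i : ℤ) ω| ∂P
      ≤ ∫ ω, (√N / 2 + (2 * √N)⁻¹ * (∑ i ∈ Finset.Icc 1 N, ε (i : ℤ) ω) ^ 2) ∂P := by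
        refine integral_mono (hS.integrable one_le_two).abs
          ((integrable_const _).add (hS.integrable_sq.const_mul _)) fun ω => ?_
        simp only
        rw [← sq_abs (∑ i ∈ Finset.Icc 1 N, ε (i : ℤ) ω)]
        generalize |∑ i ∈ Finset.Icc 1 N, ε (i : ℤ) ω| = S
        have h3 : 0 ≤ (2 * √N)⁻¹ * (√N - S) ^ 2 := by positivity
        have e : (2 * √N)⁻¹ * (√N - S) ^ 2 = √N / 2 + (2 * √N)⁻¹ * S ^ 2 - S := by
          field_simp
          ring
        linarith
    _ = (1 + V) / 2 * √N := by
        rw [integral_add (integrable_const _) (hS.integrable_sq.const_mul _), integral_const_mul,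
          h2]
        simp only [integral_const, probReal_univ, one_smul]
        field_simp
        rw [hNN]
        ring

/-- Shifting the summation window by `l` changes a sum by at most the `2 l` terms entering and
leaving it. -/
lemma abs_sum_shift_sub_le (x : ℤ → ℝ) (N l : ℕ) :
    |∑ i ∈ Finset.Icc 1 N, x ((i : ℤ) - l) - ∑ i ∈ Finset.Icc 1 N, x i| ≤
      ∑ k ∈ Finset.range l, (|x (-k)| + |x (N - k)|) := by
  induction l with
  | zero => simp
  | succ l ih =>
    have htel : ∑ i ∈ Finset.Icc 1 N, x ((i : ℤ) - (l + 1 : ℕ)) -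
        ∑ i ∈ Finset.Icc 1 N, x ((i : ℤ) - l) = x (-l) - x (N - l) := by
      clear ih
      induction N with
      | zero => simp
      | succ N ih =>
        rw [Finset.sum_Icc_succ_top (by omega), Finset.sum_Icc_succ_top (by omega)]
        have e : ((N + 1 : ℕ) : ℤ) - (l + 1 : ℕ) = N - l := by push_cast; ring
        rw [e]
        linarith
    rw [Finset.sum_range_succ]
    have h := abs_sub (x (-l)) (x (N - l))
    rw [abs_le] at ih h ⊢
    constructor <;> linarith [ih.1, ih.2, h.1, h.2]

/-- The mean of a causal stationary autoregression is of order `N^{-1/2}` in `L¹`. Summing the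
recursion over `1 ≤ i ≤ N` shows that `(1 - φ₁ - ⋯ - φ_p) ∑ x_i` equals `∑ ε_i` up to boundary terms
bounded in `L¹`. -/
theorem exists_integral_abs_sum_le {p : ℕ} {φ : Fin p → ℝ} (hφ : IsCausalPolynomial φ)
    {x ε : ℤ → Ω → ℝ} (hm : ∀ i, Measurable (x i)) (hst : IsStrictlyStationary x P)
    (hAR : SolvesAR φ x ε P) (hε : IsIIDWhiteNoise ε P) :
    (∀ i, Integrable (x i) P) ∧ ∃ C : ℝ, ∀ N : ℕ, 1 ≤ N →
      ∫ ω, |∑ i ∈ Finset.Icc 1 N, x (i : ℤ) ω| ∂P ≤ C * √N := by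
  obtain ⟨C₁, hC₁⟩ := exists_lintegral_le_of_solvesAR hφ hm hst hAR hε
  obtain ⟨C₂, hC₂⟩ := exists_integral_abs_sum_noise_le hε
  have hint : ∀ i, Integrable (x i) P := fun i =>
    ⟨(hm i).aestronglyMeasurable, (hC₁ i).trans_lt ENNReal.coe_lt_top⟩
  have habs : ∀ i, ∫ ω, |x i ω| ∂P ≤ C₁ := fun i => by
    have := integral_norm_eq_lintegral_enorm (hint i).1
    simp only [Real.norm_eq_abs] at this
    rw [this]
    exact ENNReal.toReal_le_of_le_ofReal C₁.2 (by simpa using hC₁ i)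
  refine ⟨hint, ?_⟩
  set a : ℝ := 1 - ∑ j : Fin p, φ j with ha
  have ha0 : 0 < |a| := abs_pos.2 fun h => hφ 1 (by simp) (by
    simp only [one_pow, mul_one]; rw [← Complex.ofReal_sum]; exact_mod_cast h)
  set K : ℝ := ∑ j : Fin p, |φ j| * ∑ _k ∈ Finset.range ((j : ℕ) + 1), ((C₁ : ℝ) + C₁) with hK
  have hK0 : 0 ≤ K := by positivity
  refine ⟨|a|⁻¹ * (C₂ + K), fun N hN => ?_⟩
  have hN1 : 1 ≤ √(N : ℝ) := Real.one_le_sqrt.2 (by exact_mod_cast hN)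
  set b : Fin p → Ω → ℝ := fun j ω =>
    ∑ k ∈ Finset.range ((j : ℕ) + 1), (|x (-k) ω| + |x (N - k) ω|) with hb
  have hbi : ∀ j, Integrable (b j) P := fun j =>
    integrable_finsetSum _ fun k _ => (hint _).abs.add (hint _).abs
  have hbK : ∀ j, ∫ ω, b j ω ∂P ≤ ∑ _k ∈ Finset.range ((j : ℕ) + 1), ((C₁ : ℝ) + C₁) := fun j => by
    have hi : ∀ k ∈ Finset.range ((j : ℕ) + 1),
        Integrable (fun ω => |x (-(k : ℤ)) ω| + |x (N - k) ω|) P := fun k _ =>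
      (hint _).abs.add (hint _).abs
    simp only [hb]
    rw [integral_finsetSum _ hi]
    refine Finset.sum_le_sum fun k _ => ?_
    rw [integral_add (hint _).abs (hint _).abs]
    exact add_le_add (habs _) (habs _)
  have hεi : Integrable (fun ω => |∑ i ∈ Finset.Icc 1 N, ε (i : ℤ) ω|) P :=
    (integrable_finsetSum _ fun i _ => (hε.memLp _).integrable one_le_two).abs
  have hsi : Integrable (fun ω => ∑ j : Fin p, |φ j| * b j ω) P :=
    integrable_finsetSum _ fun j _ => (hbi j).const_mul _
  have hle : ∀ᵐ ω ∂P, |∑ i ∈ Finset.Icc 1 N, x (i : ℤ) ω| ≤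
      |a|⁻¹ * (|∑ i ∈ Finset.Icc 1 N, ε (i : ℤ) ω| + ∑ j : Fin p, |φ j| * b j ω) := by
    filter_upwards [ae_all_iff.2 hAR] with ω hω
    set T := ∑ i ∈ Finset.Icc 1 N, x (i : ℤ) ω with hT
    have e : a * T = ∑ i ∈ Finset.Icc 1 N, ε (i : ℤ) ω + ∑ j : Fin p, φ j *
        (∑ i ∈ Finset.Icc 1 N, x ((i : ℤ) - ((j : ℕ) + 1 : ℕ)) ω - T) := by
      have h1 : T = ∑ j : Fin p, φ j * ∑ i ∈ Finset.Icc 1 N, x ((i : ℤ) - ((j : ℕ) + 1 : ℕ)) ω +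
          ∑ i ∈ Finset.Icc 1 N, ε (i : ℤ) ω := by
        simp only [Finset.mul_sum]
        rw [hT, Finset.sum_comm, ← Finset.sum_add_distrib]
        refine Finset.sum_congr rfl fun i _ => ?_
        rw [hω]
        push_cast
        rfl
      simp only [mul_sub, Finset.sum_sub_distrib, ← Finset.sum_mul]
      rw [ha]
      linear_combination h1
    rw [← div_eq_inv_mul, le_div_iff₀' ha0, ← abs_mul, e]
    refine (abs_add_le _ _).trans (add_le_add le_rfl ?_)
    refine (Finset.abs_sum_le_sum_abs _ _).trans (Finset.sum_le_sum fun j _ => ?_)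
    rw [abs_mul]
    exact mul_le_mul_of_nonneg_left (abs_sum_shift_sub_le (fun i => x i ω) N _) (abs_nonneg _)
  calc ∫ ω, |∑ i ∈ Finset.Icc 1 N, x (i : ℤ) ω| ∂P
      ≤ ∫ ω, |a|⁻¹ * (|∑ i ∈ Finset.Icc 1 N, ε (i : ℤ) ω| + ∑ j : Fin p, |φ j| * b j ω) ∂P :=
        integral_mono_ae (integrable_finsetSum _ fun i _ => hint _).abs
          ((hεi.add hsi).const_mul _) hle
    _ = |a|⁻¹ * (∫ ω, |∑ i ∈ Finset.Icc 1 N, ε (i : ℤ) ω| ∂P +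
          ∑ j : Fin p, |φ j| * ∫ ω, b j ω ∂P) := by
        rw [integral_const_mul, integral_add hεi hsi,
          integral_finsetSum _ fun j _ => (hbi j).const_mul _]
        simp only [integral_const_mul]
    _ ≤ |a|⁻¹ * (C₂ * √N + K) := by
        gcongr
        · exact hC₂ N
        · exact Finset.sum_le_sum fun j _ => mul_le_mul_of_nonneg_left (hbK j) (abs_nonneg _)
    _ ≤ |a|⁻¹ * (C₂ + K) * √N := by
        rw [mul_assoc]
        gcongr
        nlinarith

end Autoregression

section RealizedVariance

/-! ### Cumulative volatility -/

section volatility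

variable {σ : ℝ → ℝ} {M : ℝ}

lemma intervalIntegrable_sq (hσ : Measurable σ) (h0 : ∀ t ∈ Icc (0 : ℝ) 1, 0 ≤ σ t)
    (hM : ∀ t ∈ Icc (0 : ℝ) 1, σ t ≤ M) {a b : ℝ} (ha : 0 ≤ a) (hab : a ≤ b) (hb : b ≤ 1) :
    IntervalIntegrable (fun u => σ u ^ 2) volume a b := by
  rw [intervalIntegrable_iff_integrableOn_Ioc_of_le hab]
  refine Measure.integrableOn_of_bounded (M := M ^ 2) (by simp)
    (hσ.pow_const 2).aestronglyMeasurable ?_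
  filter_upwards [ae_restrict_mem measurableSet_Ioc] with u hu
  have hu' : u ∈ Icc (0 : ℝ) 1 := ⟨ha.trans hu.1.le, hu.2.trans hb⟩
  rw [Real.norm_of_nonneg (sq_nonneg _)]
  exact pow_le_pow_left₀ (h0 u hu') (hM u hu') 2

lemma integral_sq_le (hσ : Measurable σ) (h0 : ∀ t ∈ Icc (0 : ℝ) 1, 0 ≤ σ t)
    (hM : ∀ t ∈ Icc (0 : ℝ) 1, σ t ≤ M) {a b : ℝ} (ha : 0 ≤ a) (hab : a ≤ b) (hb : b ≤ 1) :
    ∫ u in a..b, σ u ^ 2 ≤ M ^ 2 * (b - a) := by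
  have := intervalIntegral.integral_mono_on hab (intervalIntegrable_sq hσ h0 hM ha hab hb)
    (intervalIntegrable_const (c := M ^ 2)) fun u hu => by
      have hu' : u ∈ Icc (0 : ℝ) 1 := ⟨ha.trans hu.1, hu.2.trans hb⟩
      exact pow_le_pow_left₀ (h0 u hu') (hM u hu') 2
  rw [intervalIntegral.integral_const, smul_eq_mul] at this
  linarith

lemma integral_sq_pos (hσ : Measurable σ) (h0 : ∀ t ∈ Icc (0 : ℝ) 1, 0 ≤ σ t)
    (hM : ∀ t ∈ Icc (0 : ℝ) 1, σ t ≤ M)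
    (hne : ∀ᵐ t ∂(volume.restrict (Icc (0 : ℝ) 1)), σ t ≠ 0)
    {a b : ℝ} (ha : 0 ≤ a) (hab : a < b) (hb : b ≤ 1) : 0 < ∫ u in a..b, σ u ^ 2 := by
  rw [intervalIntegral.integral_pos_iff_support_of_nonneg_ae
    (ae_of_all _ fun u => sq_nonneg (σ u)) (intervalIntegrable_sq hσ h0 hM ha hab.le hb)]
  refine ⟨hab, ?_⟩
  have hsub : Ioc a b ⊆ Icc 0 1 := fun u hu => ⟨ha.trans hu.1.le, hu.2.trans hb⟩
  have h1 : ∀ᵐ t ∂(volume.restrict (Ioc a b)), t ∈ Function.support fun u => σ u ^ 2 := by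
    filter_upwards [ae_restrict_of_ae_restrict_of_subset hsub hne] with t ht
    simpa using ht
  have hms : MeasurableSet (Function.support fun u => σ u ^ 2) :=
    measurableSet_support (hσ.pow_const 2)
  have h2 : volume.restrict (Ioc a b) (Function.support fun u => σ u ^ 2) =
      volume.restrict (Ioc a b) univ :=
    measure_congr (eventuallyEq_univ.2 h1)
  rw [← Measure.restrict_apply hms, h2, Measure.restrict_apply_univ, Real.volume_Ioc]
  simpa using hab

lemma G_sub_eq (hσ : Measurable σ) (h0 : ∀ t ∈ Icc (0 : ℝ) 1, 0 ≤ σ t)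
    (hM : ∀ t ∈ Icc (0 : ℝ) 1, σ t ≤ M) {a b : ℝ} (ha : 0 ≤ a) (hab : a ≤ b) (hb : b ≤ 1) :
    G σ b - G σ a = ∫ u in a..b, σ u ^ 2 := by
  have := intervalIntegral.integral_add_adjacent_intervals
    (intervalIntegrable_sq hσ h0 hM le_rfl ha (hab.trans hb))
    (intervalIntegrable_sq hσ h0 hM ha hab hb)
  simp only [G]
  linarith

lemma G_mono (hσ : Measurable σ) (h0 : ∀ t ∈ Icc (0 : ℝ) 1, 0 ≤ σ t)
    (hM : ∀ t ∈ Icc (0 : ℝ) 1, σ t ≤ M) {a b : ℝ} (ha : 0 ≤ a) (hab : a ≤ b) (hb : b ≤ 1) :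
    G σ a ≤ G σ b := by
  have := G_sub_eq hσ h0 hM ha hab hb
  have := intervalIntegral.integral_nonneg (μ := volume) hab fun u _ => sq_nonneg (σ u)
  linarith

lemma G_pos (hσ : Measurable σ) (h0 : ∀ t ∈ Icc (0 : ℝ) 1, 0 ≤ σ t)
    (hM : ∀ t ∈ Icc (0 : ℝ) 1, σ t ≤ M)
    (hne : ∀ᵐ t ∂(volume.restrict (Icc (0 : ℝ) 1)), σ t ≠ 0) {t : ℝ} (ht : 0 < t) (ht1 : t ≤ 1) :
    0 < G σ t := integral_sq_pos hσ h0 hM hne le_rfl ht ht1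

lemma continuousOn_H (hσ : Measurable σ) (h0 : ∀ t ∈ Icc (0 : ℝ) 1, 0 ≤ σ t)
    (hM : ∀ t ∈ Icc (0 : ℝ) 1, σ t ≤ M)
    (hne : ∀ᵐ t ∂(volume.restrict (Icc (0 : ℝ) 1)), σ t ≠ 0) :
    ContinuousOn (H σ) (Ioc 0 1) := by
  have hG : ContinuousOn (G σ) (Icc 0 1) := by
    have := intervalIntegral.continuousOn_primitive_interval (μ := volume)
      (f := fun u => σ u ^ 2) (a := 0) (b := 1) (by
        have := intervalIntegrable_sq hσ h0 hM le_rfl zero_le_one le_rfl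
        rwa [intervalIntegrable_iff_integrableOn_Icc_of_le zero_le_one,
          ← uIcc_of_le zero_le_one] at this)
    rwa [uIcc_of_le zero_le_one] at this
  exact (hG.mono Ioc_subset_Icc_self).log fun t ht => (G_pos hσ h0 hM hne ht.1 ht.2).ne'

end volatility

/-! ### Realized variance of one path -/

/-- The variance of the `j`-th of `m` increments of `∫ σ dW`, extended by zero to `j ≥ m`. -/
noncomputable def incVar (σ : ℝ → ℝ) (m j : ℕ) : ℝ≥0 :=
  if j < m then (∫ u in ((j : ℝ) / m)..(((j : ℝ) + 1) / m), σ u ^ 2).toNNReal else 0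

lemma sum_incVar {σ : ℝ → ℝ} {M : ℝ} (hσ : Measurable σ) (h0 : ∀ t ∈ Icc (0 : ℝ) 1, 0 ≤ σ t)
    (hM : ∀ t ∈ Icc (0 : ℝ) 1, σ t ≤ M) {m k : ℕ} (hk : k ≤ m) :
    ∑ j ∈ Finset.range k, (incVar σ m j : ℝ) = G σ ((k : ℝ) / m) := by
  induction k with
  | zero => simp [G]
  | succ k ih =>
    have hm : (0 : ℝ) < m := by exact_mod_cast (by omega : 0 < m)
    have hle : (k : ℝ) / m ≤ ((k : ℝ) + 1) / m := by gcongr; linarith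
    have h1 : ((k : ℝ) + 1) / m ≤ 1 := by
      rw [div_le_one hm]; exact_mod_cast hk
    rw [Finset.sum_range_succ, ih (by omega), incVar, if_pos (by omega),
      Real.coe_toNNReal _ (intervalIntegral.integral_nonneg hle fun u _ => sq_nonneg (σ u)),
      ← G_sub_eq hσ h0 hM (by positivity) hle h1]
    push_cast
    ring

lemma realizedQV_eq_sum_floor (m : ℕ) (r : ℝ → ℝ) {t : ℝ} (hm : 1 ≤ m) (ht0 : 0 ≤ t)
    (ht : t ≤ 1) : realizedQV m r t =
      ∑ j ∈ Finset.range ⌊m * t⌋₊, (r (((j : ℝ) + 1) / m) - r ((j : ℝ) / m)) ^ 2 := by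
  have hm0 : (0 : ℝ) < m := by exact_mod_cast hm
  have hfl : ⌊m * t⌋₊ ≤ m := by
    refine Nat.floor_le_of_le ?_
    nlinarith
  have hiff : ∀ j : ℕ, ((j : ℝ) + 1) / m ≤ t ↔ j < ⌊m * t⌋₊ := fun j => by
    rw [div_le_iff₀ hm0, ← Nat.succ_le_iff, Nat.le_floor_iff (by positivity), mul_comm]
    push_cast
    rfl
  simp only [realizedQV, hiff, sq_abs]
  rw [← Finset.sum_filter]
  congr 1
  ext j
  simp only [Finset.mem_filter, Finset.mem_range]
  omega

variable {Ω : Type*} [MeasurableSpace Ω] {P : Measure Ω}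

/-- The increments of `R = γ ∫ σ dW` over the grid `j / m` are `γ` times independent Gaussian
variables. -/
lemma exists_gaussian_increments {σ : ℝ → ℝ} (hσ : Measurable σ) {W : ℝ≥0 → Ω → ℝ}
    (hW : IsPreBrownianReal W P) {γ : Ω → ℝ} {R : ℝ → Ω → ℝ}
    (hR : ∀ t ∈ Icc (0 : ℝ) 1,
      ∃ J : Ω → ℝ, IsItoIntegral W σ t P J ∧ ∀ᵐ ω ∂P, R t ω = γ ω * J ω) (m : ℕ) :
    ∃ D : ℕ → Ω → ℝ, (∀ j, HasLaw (D j) (gaussianReal 0 (incVar σ m j)) P) ∧ iIndepFun D P ∧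
      ∀ᵐ ω ∂P, ∀ j < m, R (((j : ℝ) + 1) / m) ω - R ((j : ℝ) / m) ω = γ ω * D j ω := by
  have hgrid : ∀ j : ℕ, j < m → (0 : ℝ) ≤ (j : ℝ) / m ∧ (j : ℝ) / m ≤ ((j : ℝ) + 1) / m ∧
      ((j : ℝ) + 1) / m ≤ 1 := fun j hj => by
    have hm : (0 : ℝ) < m := by exact_mod_cast (by omega : 0 < m)
    exact ⟨by positivity, by gcongr; linarith, by rw [div_le_one hm]; exact_mod_cast hj⟩
  choose! J hJ hRJ using hR
  set h : ℕ → ℝ → ℝ := fun j =>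
    if j < m then (Ioc ((j : ℝ) / m) (((j : ℝ) + 1) / m)).indicator σ else 0 with hh
  set D : ℕ → Ω → ℝ := fun j => if j < m then J (((j : ℝ) + 1) / m) - J ((j : ℝ) / m) else 0 with hD
  have hWI : ∀ j, IsWienerIntegral W P (h j) (D j) := by
    intro j
    by_cases hj : j < m
    · obtain ⟨g1, g2, g3⟩ := hgrid j hj
      simp only [hh, hD, if_pos hj]
      have := ((hJ _ ⟨g1.trans g2, g3⟩).isWienerIntegral hσ).sub hW
        ((hJ _ ⟨g1, g2.trans g3⟩).isWienerIntegral hσ)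
      convert this using 1
      funext u
      simp only [Pi.sub_apply, Set.indicator_apply, Set.mem_Ioc]
      split_ifs <;> grind
    · simp only [hh, hD, if_neg hj]
      exact IsWienerIntegral.zero
  refine ⟨D, fun j => ?_, IsWienerIntegral.iIndepFun hW hWI fun i j hij u => ?_, ?_⟩
  · convert (hWI j).hasLaw hW using 2
    by_cases hj : j < m
    · simp only [incVar, hh, if_pos hj]
      rw [intervalIntegral.integral_of_le (hgrid j hj).2.1, ← integral_indicator measurableSet_Ioc]
      congr 2
      funext u
      simp only [Set.indicator_apply]
      split_ifs <;> simp
    · simp [incVar, hh, if_neg hj]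
  · by_contra hcon
    obtain ⟨h1, h2⟩ := not_or.1 (mt mul_eq_zero.2 hcon)
    have key : ∀ k, h k u ≠ 0 → (k : ℝ) < m * u ∧ m * u ≤ k + 1 := by
      intro k hk
      by_cases hkm : k < m
      · have hm : (0 : ℝ) < m := by exact_mod_cast (by omega : 0 < m)
        simp only [hh, if_pos hkm] at hk
        have := Set.mem_of_indicator_ne_zero hk
        rw [Set.mem_Ioc, div_lt_iff₀ hm, le_div_iff₀ hm] at this
        exact ⟨by linarith [this.1], by linarith [this.2]⟩
      · simp [hh, hkm] at hk
    obtain ⟨a1, a2⟩ := key i h1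
    obtain ⟨b1, b2⟩ := key j h2
    have c1 : (i : ℝ) < j + 1 := a1.trans_le b2
    have c2 : (j : ℝ) < i + 1 := b1.trans_le a2
    have c1' : i < j + 1 := by exact_mod_cast c1
    have c2' : j < i + 1 := by exact_mod_cast c2
    omega
  · rw [ae_all_iff]
    intro j
    by_cases hj : j < m
    · obtain ⟨g1, g2, g3⟩ := hgrid j hj
      filter_upwards [hRJ _ ⟨g1.trans g2, g3⟩, hRJ _ ⟨g1, g2.trans g3⟩] with ω e1 e2 _
      rw [e1, e2]
      simp only [hD, if_pos hj, Pi.sub_apply]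
      ring
    · simp [hj]

variable [IsProbabilityMeasure P]

/-- For one path, `log Q̂(t)` is within `O(Δ^{1/2})` of `2 log γ + H(t)` in `L¹`, uniformly in
`t ∈ [α, 1]`; the constant depends on `σ` and `α` only. -/
theorem exists_path_bound {σ : ℝ → ℝ} {M : ℝ} (hσ : Measurable σ)
    (h0 : ∀ t ∈ Icc (0 : ℝ) 1, 0 ≤ σ t) (hM : ∀ t ∈ Icc (0 : ℝ) 1, σ t ≤ M)
    (hne : ∀ᵐ t ∂(volume.restrict (Icc (0 : ℝ) 1)), σ t ≠ 0) {α : ℝ} (hα : α ∈ Ioo (0 : ℝ) 1) :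
    ∃ C : ℝ, ∀ (W : ℝ≥0 → Ω → ℝ) (γ : Ω → ℝ) (R : ℝ → Ω → ℝ) (m : ℕ), IsPreBrownianReal W P →
      (∀ᵐ ω ∂P, 0 < γ ω) →
      (∀ t ∈ Icc (0 : ℝ) 1, ∃ J : Ω → ℝ, IsItoIntegral W σ t P J ∧
        ∀ᵐ ω ∂P, R t ω = γ ω * J ω) → 1 ≤ m → 1 / (m : ℝ) ≤ α →
      ∃ Z : Ω → ℝ, Integrable Z P ∧ ∫ ω, Z ω ∂P ≤ C * √(1 / m) ∧
        ∀ᵐ ω ∂P, ∀ t ∈ Icc α 1, 0 < realizedQV m (fun s => R s ω) t ∧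
          |Real.log (realizedQV m (fun s => R s ω) t) - 2 * Real.log (γ ω) - H σ t| ≤ Z ω := by
  obtain ⟨hα0, hα1⟩ := hα
  set c := G σ (α / 2) with hc
  have hc0 : 0 < c := G_pos hσ h0 hM hne (by linarith) (by linarith)
  obtain ⟨C, hC⟩ := exists_log_error_bound (Ω := Ω) (B := G σ 1) hc0
  -- `M ^ 2 + 1` instead of `M ^ 2` keeps the variance bound positive
  refine ⟨C * √(M ^ 2 + 1) + M ^ 2 / c, ?_⟩
  intro W γ R m hW hγ hR hm hmα
  have hm0 : (0 : ℝ) < m := by exact_mod_cast hm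
  obtain ⟨D, hD, hind, hRD⟩ := exists_gaussian_increments hσ hW hR m
  have hmα' : 1 ≤ m * α := by rw [div_le_iff₀ hm0] at hmα; linarith
  have hgrid : ∀ j : ℕ, j < m → (0 : ℝ) ≤ (j : ℝ) / m ∧ (j : ℝ) / m < ((j : ℝ) + 1) / m ∧
      ((j : ℝ) + 1) / m ≤ 1 := fun j hj =>
    ⟨by positivity, by gcongr; linarith, by rw [div_le_one hm0]; exact_mod_cast hj⟩
  set k₀ := ⌊m * α⌋₊ with hk₀
  have hk₀1 : 1 ≤ k₀ := Nat.le_floor (by simpa using hmα')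
  have hfloor_le : ∀ t : ℝ, t ≤ 1 → ⌊m * t⌋₊ ≤ m := fun t ht => by
    refine Nat.floor_le_of_le ?_
    nlinarith
  have hk₀α : α / 2 ≤ (k₀ : ℝ) / m := by
    rw [le_div_iff₀ hm0]
    have h1 := Nat.lt_floor_add_one (m * α)
    have h2 : (1 : ℝ) ≤ k₀ := by exact_mod_cast hk₀1
    rw [← hk₀] at h1
    linarith
  have hvpos : ∀ j < m, 0 < incVar σ m j := fun j hj => by
    obtain ⟨g1, g2, g3⟩ := hgrid j hj
    rw [incVar, if_pos hj, Real.toNNReal_pos]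
    exact integral_sq_pos hσ h0 hM hne g1 g2 g3
  have hvle : ∀ j < m, (incVar σ m j : ℝ) ≤ (M ^ 2 + 1) * (1 / m) := fun j hj => by
    obtain ⟨g1, g2, g3⟩ := hgrid j hj
    rw [incVar, if_pos hj, Real.coe_toNNReal _
      (intervalIntegral.integral_nonneg g2.le fun u _ => sq_nonneg (σ u))]
    refine (integral_sq_le hσ h0 hM g1 g2.le g3).trans ?_
    have : ((j : ℝ) + 1) / m - (j : ℝ) / m = 1 / m := by ring
    rw [this]
    gcongr
    linarith
  obtain ⟨Z, hZ, hZint, hZle⟩ := hC P D (incVar σ m) ((M ^ 2 + 1) * (1 / m)) k₀ m (by positivity)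
    hk₀1 (hfloor_le α hα1.le) hvpos hvle hD hind
    (by
      rw [sum_incVar hσ h0 hM (hfloor_le α hα1.le)]
      exact G_mono hσ h0 hM (by linarith) hk₀α
        (by rw [div_le_one hm0]; exact_mod_cast hfloor_le α hα1.le))
    (by rw [sum_incVar hσ h0 hM le_rfl, div_self hm0.ne'])
  refine ⟨fun ω => Z ω + M ^ 2 / c * (1 / m), hZ.add (integrable_const _), ?_, ?_⟩
  · rw [integral_add hZ (integrable_const _)]
    simp only [integral_const, probReal_univ, one_smul]
    have h1 : 1 / (m : ℝ) ≤ √(1 / m) := by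
      have : (1 : ℝ) ≤ m := by exact_mod_cast hm
      refine Real.le_sqrt_of_sq_le ?_
      have h2 : 1 / (m : ℝ) ≤ 1 := by rw [div_le_one hm0]; exact this
      have h3 : 0 ≤ 1 / (m : ℝ) := by positivity
      nlinarith
    rw [Real.sqrt_mul (by positivity)] at hZint
    have h2 : M ^ 2 / c * (1 / m) ≤ M ^ 2 / c * √(1 / m) := by gcongr
    linarith
  · have hD0 : ∀ᵐ ω ∂P, D 0 ω ≠ 0 := ae_ne_zero_of_gaussian (hvpos 0 (by omega)) (hD 0)
    filter_upwards [hγ, hRD, hZle, hD0] with ω hγω hω hZω hDω t ht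
    have ht0 : 0 < t := hα0.trans_le ht.1
    set k := ⌊m * t⌋₊ with hk
    have hkm : k ≤ m := hfloor_le t ht.2
    have hkk : k₀ ≤ k := Nat.floor_le_floor (by gcongr; exact ht.1)
    have hQ : realizedQV m (fun s => R s ω) t = γ ω ^ 2 * ∑ j ∈ Finset.range k, D j ω ^ 2 := by
      rw [realizedQV_eq_sum_floor m _ hm ht0.le ht.2, Finset.mul_sum]
      refine Finset.sum_congr rfl fun j hj => ?_
      rw [hω j ((Finset.mem_range.1 hj).trans_le hkm), mul_pow]
    have hS : 0 < ∑ j ∈ Finset.range k, D j ω ^ 2 :=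
      Finset.sum_pos' (fun j _ => sq_nonneg _) ⟨0, by simp; omega, by positivity⟩
    refine ⟨by rw [hQ]; positivity, ?_⟩
    have h1 := hZω k hkk hkm
    rw [sum_incVar hσ h0 hM hkm] at h1
    have hkt : (k : ℝ) / m ≤ t := by
      rw [div_le_iff₀ hm0, mul_comm]; exact Nat.floor_le (by positivity)
    have htk : t - (k : ℝ) / m ≤ 1 / m := by
      have := Nat.lt_floor_add_one (m * t)
      rw [← hk] at this
      rw [sub_le_iff_le_add, ← add_div, le_div_iff₀ hm0]
      linarith
    have hkc : α / 2 ≤ (k : ℝ) / m := hk₀α.trans (by gcongr)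
    have h2 : |Real.log (G σ ((k : ℝ) / m)) - H σ t| ≤ M ^ 2 / c * (1 / m) := by
      refine (abs_log_sub_log_le hc0 (G_mono hσ h0 hM (by linarith) hkc (hkt.trans ht.2))
        (G_mono hσ h0 hM (by linarith) (hkc.trans hkt) ht.2)).trans ?_
      rw [abs_sub_comm, G_sub_eq hσ h0 hM (by linarith) hkt ht.2,
        abs_of_nonneg (intervalIntegral.integral_nonneg hkt fun u _ => sq_nonneg (σ u))]
      calc _ ≤ M ^ 2 * (1 / m) / c := by
            gcongr
            exact (integral_sq_le hσ h0 hM (by linarith) hkt ht.2).trans (by gcongr)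
        _ = _ := by ring
    rw [hQ, Real.log_mul (by positivity) hS.ne', Real.log_pow]
    rw [abs_le] at h1 h2 ⊢
    push_cast
    constructor <;> linarith [h1.1, h1.2, h2.1, h2.2]

end RealizedVariance

section Rates

/-! ### Measurability of the supremum -/

lemma le_supAbs {α : ℝ} (f : ℝ → ℝ) {t : ℝ} (ht : t ∈ Icc α 1) :
    ENNReal.ofReal |f t| ≤ supAbs α f := le_iSup₂_of_le t ht le_rfl

lemma supAbs_le {α : ℝ} {f : ℝ → ℝ} {c : ℝ≥0∞}
    (h : ∀ t ∈ Icc α 1, ENNReal.ofReal |f t| ≤ c) : supAbs α f ≤ c := iSup₂_le h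

/-- For a right-continuous function the supremum over `[α, 1]` is attained along the rationals and
the right end point. -/
lemma supAbs_eq_iSup_countable {α : ℝ} {f : ℝ → ℝ}
    (hf : ∀ t ∈ Ico α 1, Tendsto f (𝓝[>] t) (𝓝 (f t))) :
    supAbs α f = ⨆ t ∈ (insert 1 (range ((↑) : ℚ → ℝ))) ∩ Icc α 1, ENNReal.ofReal |f t| := by
  refine le_antisymm (supAbs_le fun t ht => ?_) (iSup₂_le fun t ht => le_supAbs f ht.2)
  rcases ht.2.lt_or_eq with h1 | rfl
  · have hlim : Tendsto (fun s => ENNReal.ofReal |f s|) (𝓝[>] t) (𝓝 (ENNReal.ofReal |f t|)) :=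
      (ENNReal.continuous_ofReal.tendsto _).comp ((continuous_abs.tendsto _).comp (hf t ⟨ht.1, h1⟩))
    refine le_of_tendsto_of_frequently hlim ?_
    rw [(nhdsGT_basis t).frequently_iff]
    intro u hu
    obtain ⟨q, hq1, hq2⟩ := exists_rat_btwn (lt_min hu h1)
    exact ⟨q, ⟨hq1, hq2.trans_le (min_le_left _ _)⟩,
      le_iSup₂_of_le (q : ℝ) ⟨Or.inr ⟨q, rfl⟩, ht.1.trans hq1.le, hq2.le.trans (min_le_right _ _)⟩
        le_rfl⟩
  · exact le_iSup₂_of_le (1 : ℝ) ⟨Or.inl rfl, ht⟩ le_rfl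

lemma realizedQV_eventuallyEq_nhdsGT (m : ℕ) (r : ℝ → ℝ) (t : ℝ) :
    ∀ᶠ s in 𝓝[>] t, realizedQV m r s = realizedQV m r t := by
  have h : ∀ k ∈ Finset.range m, ∀ᶠ s in 𝓝[>] t,
      (((k : ℝ) + 1) / m ≤ s ↔ ((k : ℝ) + 1) / m ≤ t) := by
    intro k _
    rcases le_or_gt (((k : ℝ) + 1) / m) t with hk | hk
    · filter_upwards [self_mem_nhdsWithin] with s hs
      exact iff_of_true (hk.trans (mem_Ioi.1 hs).le) hk
    · filter_upwards [nhdsWithin_le_nhds (Iio_mem_nhds hk)] with s hs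
      exact iff_of_false (not_le.2 hs) (not_le.2 hk)
  filter_upwards [(Finset.eventually_all _).2 h] with s hs
  exact Finset.sum_congr rfl fun k hk => by simp only [hs k hk]

variable {Ω : Type*} [MeasurableSpace Ω] {P : Measure Ω}

lemma aemeasurable_realizedQV {m : ℕ} {R : ℝ → Ω → ℝ}
    (hR : ∀ t ∈ Icc (0 : ℝ) 1, AEMeasurable (R t) P) (t : ℝ) :
    AEMeasurable (fun ω => realizedQV m (fun s => R s ω) t) P := by
  simp only [realizedQV]
  refine Finset.aemeasurable_fun_sum _ fun k hk => ?_
  split_ifs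
  · have hk' := Finset.mem_range.1 hk
    have hm : (0 : ℝ) < m := by exact_mod_cast (by omega : 0 < m)
    have h1 : ((k : ℝ) + 1) / m ≤ 1 := by rw [div_le_one hm]; exact_mod_cast hk'
    have h2 : (k : ℝ) / m ≤ ((k : ℝ) + 1) / m := by gcongr; linarith
    have := (hR _ ⟨by positivity, h1⟩).sub (hR ((k : ℝ) / m) ⟨by positivity, h2.trans h1⟩)
    exact (continuous_abs.measurable.comp_aemeasurable this).pow_const 2
  · exact aemeasurable_const

lemma aemeasurable_supAbs_Hhat {R : ℤ → ℝ → Ω → ℝ}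
    (hR : ∀ i, ∀ t ∈ Icc (0 : ℝ) 1, AEMeasurable (R i t) P) {h : ℝ → ℝ} {α : ℝ}
    (hα : 0 < α) (hh : ContinuousOn h (Ioc 0 1)) (N m : ℕ) :
    AEMeasurable (fun ω => supAbs α fun t => Hhat R N m t ω - h t) P := by
  have heq : ∀ ω, supAbs α (fun t => Hhat R N m t ω - h t) =
      ⨆ t ∈ (insert 1 (range ((↑) : ℚ → ℝ))) ∩ Icc α 1, ENNReal.ofReal |Hhat R N m t ω - h t| := by
    intro ω
    refine supAbs_eq_iSup_countable fun t ht => ?_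
    have h1 : Tendsto (fun s => Hhat R N m s ω) (𝓝[>] t) (𝓝 (Hhat R N m t ω)) := by
      refine tendsto_const_nhds.congr' (EventuallyEq.symm ?_)
      have : ∀ᶠ s in 𝓝[>] t, ∀ i ∈ Finset.Icc 1 N, realizedQV m (fun s => R (i : ℕ) s ω) s =
          realizedQV m (fun s => R (i : ℕ) s ω) t :=
        (Finset.eventually_all _).2 fun i _ => realizedQV_eventuallyEq_nhdsGT m _ t
      filter_upwards [this] with s hs
      simp only [Hhat]
      congr 1
      exact Finset.sum_congr rfl fun i hi => by rw [hs i hi]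
    have h2 : Tendsto h (𝓝[>] t) (𝓝 (h t)) := by
      have h3 : Tendsto h (𝓝[Ioc t 1] t) (𝓝 (h t)) :=
        (hh t ⟨hα.trans_le ht.1, ht.2.le⟩).mono_left
          (nhdsWithin_mono _ (Ioc_subset_Ioc_left (hα.le.trans ht.1)))
      rwa [nhdsWithin_Ioc_eq_nhdsGT ht.2] at h3
    exact h1.sub h2
  simp only [heq]
  refine AEMeasurable.biSup _ (((countable_range _).insert _).mono inter_subset_left) fun t _ => ?_
  refine ENNReal.measurable_ofReal.comp_aemeasurable
    (continuous_abs.measurable.comp_aemeasurable (AEMeasurable.sub_const (f := Hhat R N m t) ?_ _))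
  unfold Hhat
  refine (Finset.aemeasurable_fun_sum _ fun i _ => ?_).const_mul _
  exact Real.measurable_log.comp_aemeasurable (aemeasurable_realizedQV (hR _) t)

/-! ### The convergence rates -/

lemma rate_eq (N m : ℕ) : rate N m = (√N)⁻¹ + √(1 / m) := by
  rw [rate, Real.sqrt_eq_rpow, Real.sqrt_eq_rpow, Real.rpow_neg (Nat.cast_nonneg N)]

lemma rate_pos {N m : ℕ} (hN : 1 ≤ N) : 0 < rate N m := by
  have : (0 : ℝ) < N := by exact_mod_cast hN
  rw [rate_eq]
  positivity

lemma rate_le_two {N m : ℕ} (hN : 1 ≤ N) (hm : 1 ≤ m) : rate N m ≤ 2 := by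
  have hN1 : (1 : ℝ) ≤ N := by exact_mod_cast hN
  have hm1 : (1 : ℝ) ≤ m := by exact_mod_cast hm
  have h1 : (√(N : ℝ))⁻¹ ≤ 1 := inv_le_one_of_one_le₀ (Real.one_le_sqrt.2 hN1)
  have h2 : √(1 / (m : ℝ)) ≤ 1 := Real.sqrt_le_one.2 (by rw [div_le_one (by linarith)]; exact hm1)
  rw [rate_eq]
  linarith

lemma abs_exp_sub_one_le_mul_exp (x : ℝ) : |Real.exp x - 1| ≤ |x| * Real.exp |x| := by
  rcases le_total 0 x with hx | hx
  · rw [abs_of_nonneg hx, abs_of_nonneg (by linarith [Real.add_one_le_exp x])]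
    have h1 := Real.add_one_le_exp (-x)
    have h2 : Real.exp (-x) * Real.exp x = 1 := by rw [← Real.exp_add]; simp
    nlinarith [Real.exp_pos x]
  · rw [abs_of_nonpos hx, abs_of_nonpos (by linarith [Real.exp_le_one_iff.2 hx])]
    have h1 := Real.add_one_le_exp x
    have h2 := Real.one_le_exp (neg_nonneg.2 hx)
    nlinarith

end Rates

end FunctionalSV

theorem mainTheorem8 {Ω : Type*} [MeasurableSpace Ω] (P : Measure Ω) [IsProbabilityMeasure P]
    {p : ℕ} (φ : Fin p → ℝ) (hφ : FunctionalSV.IsCausalPolynomial φ)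
    (σ : ℝ → ℝ) (hσ_meas : Measurable σ) (hσ_nonneg : ∀ t ∈ Icc (0 : ℝ) 1, 0 ≤ σ t)
    (hσ_bdd : ∃ M : ℝ, ∀ t ∈ Icc (0 : ℝ) 1, σ t ≤ M)
    (hσ_ne : ∀ᵐ t ∂(volume.restrict (Icc (0 : ℝ) 1)), σ t ≠ 0)
    (W : ℤ → ℝ≥0 → Ω → ℝ) (hW_meas : ∀ i t, Measurable (W i t))
    (hW : ∀ i, IsBrownianReal (W i) P)
    (hW_indep : iIndepFun (fun (i : ℤ) (ω : Ω) (t : ℝ≥0) => W i t ω) P)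
    (g : ℤ → Ω → ℝ) (hg_meas : ∀ i, Measurable (g i)) (hg_pos : ∀ i, ∀ᵐ ω ∂P, 0 < g i ω)
    (hWg : IndepFun (fun (ω : Ω) (q : ℤ × ℝ≥0) => W q.1 q.2 ω) (fun (ω : Ω) (i : ℤ) => g i ω) P)
    (ε : ℤ → Ω → ℝ) (hε : FunctionalSV.IsIIDWhiteNoise ε P)
    (hg_stat : FunctionalSV.IsStrictlyStationary (fun i ω => Real.log (g i ω)) P)
    (hg_AR : FunctionalSV.SolvesAR φ (fun i ω => Real.log (g i ω)) ε P)
    (R : ℤ → ℝ → Ω → ℝ)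
    (hR : ∀ i : ℤ, ∀ t ∈ Icc (0 : ℝ) 1,
      ∃ J : Ω → ℝ, FunctionalSV.IsItoIntegral (W i) σ t P J ∧ ∀ᵐ ω ∂P, R i t ω = g i ω * J ω)
    (α : ℝ) (hα : α ∈ Ioo (0 : ℝ) 1) :
    -- the logarithms are well defined and the supremum of `|Ĥ - H|` is a random variable
    (∀ m : ℕ, 1 ≤ m → 1 / (m : ℝ) ≤ α →
      ∀ i : ℤ, ∀ᵐ ω ∂P, ∀ t ∈ Icc α 1, 0 < FunctionalSV.realizedQV m (fun s => R i s ω) t) ∧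
    (∀ N m : ℕ, 1 ≤ N → 1 ≤ m → 1 / (m : ℝ) ≤ α →
      AEMeasurable (fun ω => FunctionalSV.supAbs α
        (fun t => FunctionalSV.Hhat R N m t ω - FunctionalSV.H σ t)) P) ∧
    -- rate in `L¹` for `Ĥ`
    (∃ C : ℝ, ∀ N m : ℕ, 1 ≤ N → 1 ≤ m → 1 / (m : ℝ) ≤ α →
      ∫⁻ ω, FunctionalSV.supAbs α
          (fun t => FunctionalSV.Hhat R N m t ω - FunctionalSV.H σ t) ∂P
        ≤ ENNReal.ofReal (C * FunctionalSV.rate N m)) ∧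
    -- rate in probability for `Ĝ`
    (∀ δ : ℝ, 0 < δ → ∃ K : ℝ, ∀ N m : ℕ, 1 ≤ N → 1 ≤ m → 1 / (m : ℝ) ≤ α →
      P {ω | ENNReal.ofReal (K * FunctionalSV.rate N m) <
          FunctionalSV.supAbs α
            (fun t => FunctionalSV.Ghat R N m t ω - FunctionalSV.G σ t)}
        ≤ ENNReal.ofReal δ) := by
  obtain ⟨M, hM⟩ := hσ_bdd
  obtain ⟨hα0, hα1⟩ := hα
  obtain ⟨C₁, hC₁⟩ := FunctionalSV.exists_path_bound (P := P) hσ_meas hσ_nonneg hM hσ_ne ⟨hα0, hα1⟩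
  obtain ⟨hint, C₂, hC₂⟩ := FunctionalSV.exists_integral_abs_sum_le hφ
    (fun i => Real.measurable_log.comp (hg_meas i)) hg_stat hg_AR hε
  have hpath := fun (i : ℤ) (m : ℕ) (hm : 1 ≤ m) (hmα : 1 / (m : ℝ) ≤ α) =>
    hC₁ (W i) (g i) (R i) m (hW i).toIsPreBrownianReal (hg_pos i) (hR i) hm hmα
  have hRm : ∀ i, ∀ t ∈ Icc (0 : ℝ) 1, AEMeasurable (R i t) P := fun i t ht => by
    obtain ⟨J, hJ, hRJ⟩ := hR i t ht
    exact ((hg_meas i).aemeasurable.mul hJ.1.aemeasurable).congr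
      (hRJ.mono fun ω h => by simp [h])
  have hmeas := fun N m : ℕ => FunctionalSV.aemeasurable_supAbs_Hhat hRm hα0
    (FunctionalSV.continuousOn_H hσ_meas hσ_nonneg hM hσ_ne) N m
  -- the constant of the `L¹` rate, taken positive so that Markov's inequality applies to it below
  have hL1 : ∃ C : ℝ, 0 < C ∧ ∀ N m : ℕ, 1 ≤ N → 1 ≤ m → 1 / (m : ℝ) ≤ α →
      ∫⁻ ω, FunctionalSV.supAbs α
          (fun t => FunctionalSV.Hhat R N m t ω - FunctionalSV.H σ t) ∂P
        ≤ ENNReal.ofReal (C * FunctionalSV.rate N m) := by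
    refine ⟨2 * |C₂| + |C₁| + 1, by positivity, fun N m hN hm hmα => ?_⟩
    have hN0 : (0 : ℝ) < N := by exact_mod_cast hN
    choose Z hZ hZint hZle using fun i : ℕ => hpath (i : ℤ) m hm hmα
    set U : Ω → ℝ := fun ω => 1 / (N : ℝ) * (2 * |∑ i ∈ Finset.Icc 1 N, Real.log (g (i : ℤ) ω)| +
      ∑ i ∈ Finset.Icc 1 N, Z i ω) with hU
    have hi1 : Integrable (fun ω => 2 * |∑ i ∈ Finset.Icc 1 N, Real.log (g (i : ℤ) ω)|) P :=
      (integrable_finsetSum _ fun i _ => hint _).abs.const_mul 2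
    have hi2 : Integrable (fun ω => ∑ i ∈ Finset.Icc 1 N, Z i ω) P :=
      integrable_finsetSum _ fun i _ => hZ i
    have hUi : Integrable U P := (hi1.add hi2).const_mul _
    have hle : ∀ᵐ ω ∂P, ∀ t ∈ Icc α 1,
        |FunctionalSV.Hhat R N m t ω - FunctionalSV.H σ t| ≤ U ω := by
      filter_upwards [ae_all_iff.2 hZle] with ω hω t ht
      have e : FunctionalSV.Hhat R N m t ω - FunctionalSV.H σ t = 1 / (N : ℝ) *
          (2 * ∑ i ∈ Finset.Icc 1 N, Real.log (g (i : ℤ) ω) + ∑ i ∈ Finset.Icc 1 N,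
            (Real.log (FunctionalSV.realizedQV m (fun s => R (i : ℤ) s ω) t) -
              2 * Real.log (g (i : ℤ) ω) - FunctionalSV.H σ t)) := by
        simp only [FunctionalSV.Hhat, Finset.sum_sub_distrib, ← Finset.mul_sum, Finset.sum_const,
          Nat.card_Icc, Nat.add_sub_cancel, nsmul_eq_mul]
        field_simp
        ring
      rw [e, abs_mul, abs_of_pos (by positivity)]
      refine mul_le_mul_of_nonneg_left ((abs_add_le _ _).trans (add_le_add ?_ ?_)) (by positivity)
      · rw [abs_mul, abs_two]
      · exact (Finset.abs_sum_le_sum_abs _ _).trans (Finset.sum_le_sum fun i _ => (hω i t ht).2)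
    have hU0 : 0 ≤ᵐ[P] U := by
      filter_upwards [hle] with ω hω
      exact (abs_nonneg _).trans (hω 1 ⟨hα1.le, le_rfl⟩)
    calc _ ≤ ∫⁻ ω, ENNReal.ofReal (U ω) ∂P := by
          refine lintegral_mono_ae (hle.mono fun ω hω => ?_)
          exact FunctionalSV.supAbs_le fun t ht => ENNReal.ofReal_le_ofReal (hω t ht)
      _ = ENNReal.ofReal (∫ ω, U ω ∂P) := (ofReal_integral_eq_lintegral_ofReal hUi hU0).symm
      _ ≤ _ := ENNReal.ofReal_le_ofReal ?_
    have hs : (0 : ℝ) < √N := Real.sqrt_pos.2 hN0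
    have hNN : √(N : ℝ) ^ 2 = N := Real.sq_sqrt hN0.le
    calc ∫ ω, U ω ∂P = 1 / (N : ℝ) * (2 * ∫ ω, |∑ i ∈ Finset.Icc 1 N, Real.log (g (i : ℤ) ω)| ∂P +
          ∑ i ∈ Finset.Icc 1 N, ∫ ω, Z i ω ∂P) := by
          rw [hU, integral_const_mul, integral_add hi1 hi2, integral_const_mul,
            integral_finsetSum _ fun i _ => hZ i]
      _ ≤ 1 / (N : ℝ) * (2 * (C₂ * √N) + ∑ _i ∈ Finset.Icc 1 N, C₁ * √(1 / m)) := by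
          gcongr
          · exact hC₂ N hN
          · exact hZint _
      _ = 2 * C₂ * (√N)⁻¹ + C₁ * √(1 / m) := by
          simp only [Finset.sum_const, Nat.card_Icc, Nat.add_sub_cancel, nsmul_eq_mul]
          rw [← hNN]
          generalize √(1 / (m : ℝ)) = d
          rw [Real.sqrt_sq hs.le]
          field_simp
      _ ≤ (2 * |C₂| + |C₁| + 1) * (√N)⁻¹ + (2 * |C₂| + |C₁| + 1) * √(1 / m) := by
          gcongr
          · linarith [le_abs_self C₂, abs_nonneg C₁]
          · linarith [le_abs_self C₁, abs_nonneg C₂]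
      _ = _ := by rw [FunctionalSV.rate_eq, mul_add]
  refine ⟨fun m hm hmα i => ?_, fun N m _ _ _ => hmeas N m, ?_, ?_⟩
  · obtain ⟨Z, -, -, hZ⟩ := hpath i m hm hmα
    filter_upwards [hZ] with ω hω t ht using (hω t ht).1
  · obtain ⟨C, -, hC⟩ := hL1
    exact ⟨C, hC⟩
  · intro δ hδ
    obtain ⟨C, hC0, hC⟩ := hL1
    have hG1 : 0 < FunctionalSV.G σ 1 :=
      FunctionalSV.G_pos hσ_meas hσ_nonneg hM hσ_ne zero_lt_one le_rfl
    refine ⟨FunctionalSV.G σ 1 * (C / δ * Real.exp (C / δ * 2)), fun N m hN hm hmα => ?_⟩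
    have hr := FunctionalSV.rate_pos (m := m) hN
    have hr2 := FunctionalSV.rate_le_two hN hm
    set r := FunctionalSV.rate N m with hr_def
    -- where `|Ĥ - H|` is small, the mean value inequality for `exp` controls `|Ĝ - G|`
    have hsub : {ω | ENNReal.ofReal (FunctionalSV.G σ 1 * (C / δ * Real.exp (C / δ * 2)) * r) <
          FunctionalSV.supAbs α (fun t => FunctionalSV.Ghat R N m t ω - FunctionalSV.G σ t)} ⊆
        {ω | ENNReal.ofReal (C / δ * r) ≤ FunctionalSV.supAbs α
          (fun t => FunctionalSV.Hhat R N m t ω - FunctionalSV.H σ t)} := by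
      intro ω hω
      by_contra hcon
      refine absurd hω (not_lt.2 (FunctionalSV.supAbs_le fun t ht => ?_))
      have hGt : 0 < FunctionalSV.G σ t := FunctionalSV.G_pos hσ_meas hσ_nonneg hM hσ_ne
        (hα0.trans_le ht.1) ht.2
      have hx : |FunctionalSV.Hhat R N m t ω - FunctionalSV.H σ t| ≤ C / δ * r := by
        have h1 := (FunctionalSV.le_supAbs
          (fun t => FunctionalSV.Hhat R N m t ω - FunctionalSV.H σ t) ht).trans (not_le.1 hcon).le
        exact (ENNReal.ofReal_le_ofReal_iff (by positivity)).1 h1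
      refine ENNReal.ofReal_le_ofReal ?_
      set x := FunctionalSV.Hhat R N m t ω - FunctionalSV.H σ t with hx_def
      have e : FunctionalSV.Ghat R N m t ω - FunctionalSV.G σ t =
          FunctionalSV.G σ t * (Real.exp x - 1) := by
        rw [hx_def, Real.exp_sub, FunctionalSV.H, Real.exp_log hGt, FunctionalSV.Ghat]
        field_simp
      rw [e, abs_mul, abs_of_pos hGt]
      calc _ ≤ FunctionalSV.G σ 1 * (|x| * Real.exp |x|) := by
            gcongr
            · exact FunctionalSV.G_mono hσ_meas hσ_nonneg hM (hα0.le.trans ht.1) ht.2 le_rfl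
            · exact FunctionalSV.abs_exp_sub_one_le_mul_exp x
        _ ≤ FunctionalSV.G σ 1 * (C / δ * r * Real.exp (C / δ * 2)) := by
            gcongr
            exact hx.trans (by gcongr)
        _ = _ := by ring
    calc _ ≤ P {ω | ENNReal.ofReal (C / δ * r) ≤ FunctionalSV.supAbs α
          (fun t => FunctionalSV.Hhat R N m t ω - FunctionalSV.H σ t)} := measure_mono hsub
      _ ≤ (∫⁻ ω, FunctionalSV.supAbs α
          (fun t => FunctionalSV.Hhat R N m t ω - FunctionalSV.H σ t) ∂P) /
            ENNReal.ofReal (C / δ * r) :=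
          meas_ge_le_lintegral_div (hmeas N m)
            (by simpa using (by positivity : 0 < C / δ * r)) ENNReal.ofReal_ne_top
      _ ≤ ENNReal.ofReal (C * r) / ENNReal.ofReal (C / δ * r) := by
          gcongr
          exact hC N m hN hm hmα
      _ = ENNReal.ofReal δ := by
          rw [← ENNReal.ofReal_div_of_pos (by positivity)]
          congr 1
          field_simp
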